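/- **Setting.** Let $G=(A\cup B,E)$ be a finite simple bipartite graph with edge weights $w_e\in\mathbb R$ and probabilities $p_e\in(0,1]$; each edge is realized independently with probability $p_e$. Let $\mathrm{OPT}$ be the expected maximum weight of a matching in the realized subgraph, and assume $\mathrm{OPT}>0$. For a vertex $u$ let $E_u$ be the set of edges at $u$. Let $x=(x_e)_{e\in E}$ be an optimal solution of the linear program $$\max\ \sum_{e\in E}w_ex_e\quad\text{s.t.}\quad \sum_{e\in F}x_e\le 1-\prod_{e\in F}(1-p_e)\ \ (u\in A\cup B,\ F\subseteq E_u),\qquad x_e\ge 0\ \ (e\in E),$$ and let $\mathrm{OPT}_{LP}=\sum_{e\in E}w_ex_e$. **The constants.** For $0\le x\le\sigma\le 1$, $\sigma>0$, let $g(x,\sigma)=\frac{(e^\sigma-1)(\sigma-x)x}{\sigma(e^\sigma-e^x)}$ if $x<\sigma$, and $g(\sigma,\sigma)=1-e^{-\sigma}$. Let $3/4\le\tau<1$. Let $\varphi(\tau)$ be the smallest $x\in(0,1]$ such that $g(x',1)/x'\le\tau$ for all $x'\in[x,1]$, and let $\rho(\tau)$ be the largest $x\in(0,1]$ such that $x\le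 1-(1-\varphi(\tau)/\tau)^{x/\varphi(\tau)}$. Let $H\subseteq E$ be the set of heavy edges, i.e. those with $g(x_e,1)/p_e\ge\tau$; edges for which equality holds may be put into $H$ or left out of it, arbitrarily. Let $H_u=H\cap E_u$ and $\omega_H=\sum_{e\in H}w_ex_e$. **The algorithm** $\mathrm{Alg1}(A,B,H,x,\sigma)$, for $\sigma$ with $\sum_{e\in H_u}x_e\le\sigma$ for all $u\in B$. For each $u\in B$ add a dummy edge with $w_e=0$, $p_e=1$ and $x_e=\sigma-\sum_{e'\in H_u}x_{e'}$ from $u$ to a new vertex of degree one, which is added to $A$. Let $\tilde x_e=g(x_e,\sigma)$ for every edge $e$ of this extended graph. For each $v$ in the extended $A$ let $\mathcal D_v$ be a distribution over permutations of subsets of the edges at $v$ that is proportional to $x$: if the edges of a permutation drawn from $\mathcal D_v$ are examined in order, each edge $e$ at $v$ is the first realized one with probability exactly $x_e$. Start with $\mathcal M=\emptyset$ and process the vertices $v$ of the extended $A$ in uniformly random order. For each $v$, draw a permutation from $\mathcal D_v$ and thin it: go through its edges $e$ in order and, with fresh $c$ uniform on $[0,1]$, stop if $c\le p_e(1-\tilde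 x_e/x_e)$, keep $e$ if $p_e(1-\tilde x_e/x_e)<c\le p_e(1-\tilde x_e/x_e)+\tilde x_e/x_e$, and skip $e$ otherwise. Then examine the kept edges in order until one, $e=(v,u)$, is realized; add $e$ to $\mathcal M$ if $u$ is still unmatched. All random choices are independent. Let $w(\mathcal M)=\sum_{e\in\mathcal M}w_e$. **Lemma.** The numbers $\varphi(\tau)$ and $\rho(\tau)$ exist, $0<\rho(\tau)<1$, and $\sum_{e\in H_u}x_e\le\rho(\tau)$ for every $u\in A\cup B$. Proportional distributions $\mathcal D_v$ as required by $\mathrm{Alg1}(A,B,H,x,\rho(\tau))$ exist, and for every choice of them the set $\mathcal M$ returned by $\mathrm{Alg1}(A,B,H,x,\rho(\tau))$ is always a matching of the extended graph and satisfies $$\frac{\mathbb E[w(\mathcal M)]}{\mathrm{OPT}}\ \ge\ \frac{1-e^{-\rho(\tau)}}{\rho(\tau)}\cdot\frac{\omega_H}{\mathrm{OPT}_{LP}}.$$ -/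

import Mathlib

open MeasureTheory

noncomputable section

namespace StochMatch

/-! ### The transformation function and the constants `φ(τ)`, `ρ(τ)` -/

/-- The transformation `g(x, σ)`, extended to `x = σ` by its limit `1 - e^{-σ}`. -/
def g (x σ : ℝ) : ℝ :=
  if x = σ then 1 - Real.exp (-σ)
  else (Real.exp σ - 1) * (σ - x) * x / (σ * (Real.exp σ - Real.exp x))

/-- The thresholds `x ∈ (0,1]` from which on `g(x', 1) / x' ≤ τ`. -/
def phiSet (τ : ℝ) : Set ℝ :=
  {x | x ∈ Set.Ioc (0 : ℝ) 1 ∧ ∀ x' ∈ Set.Icc x 1, g x' 1 / x' ≤ τ}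

/-- `φ(τ)`: the smallest such threshold. -/
def phi (τ : ℝ) : ℝ := sInf (phiSet τ)

/-- The `x ∈ (0,1]` with `x ≤ 1 - (1 - φ(τ)/τ)^(x/φ(τ))`. -/
def rhoSet (τ : ℝ) : Set ℝ :=
  {x | x ∈ Set.Ioc (0 : ℝ) 1 ∧ x ≤ 1 - (1 - phi τ / τ) ^ (x / phi τ)}

/-- `ρ(τ)`: the largest such `x`. -/
def rho (τ : ℝ) : ℝ := sSup (rhoSet τ)

/-! ### Stochastic bipartite graphs: an edge is a pair in `V × B` -/

section Graph

variable {V B : Type*} [DecidableEq V] [DecidableEq B]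

/-- A set of edges no two of which share an end-point. -/
def IsMatching (M : Finset (V × B)) : Prop :=
  ∀ e ∈ M, ∀ f ∈ M, e ≠ f → e.1 ≠ f.1 ∧ e.2 ≠ f.2

/-- Probability that at least one edge of `F` exists (edges exist independently). -/
def prExists (p : V × B → ℝ) (F : Finset (V × B)) : ℝ := 1 - ∏ e ∈ F, (1 - p e)

/-- Feasible solutions of the linear program: for every vertex and every set `F` of edges incident
to it, `∑_{e ∈ F} x_e ≤ Pr[an edge in F exists]`. -/
def LPFeasible (E : Finset (V × B)) (p x : V × B → ℝ) : Prop :=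
  (∀ e ∈ E, 0 ≤ x e) ∧
  (∀ v : V, ∀ F ⊆ E, (∀ e ∈ F, e.1 = v) → ∑ e ∈ F, x e ≤ prExists p F) ∧
  (∀ u : B, ∀ F ⊆ E, (∀ e ∈ F, e.2 = u) → ∑ e ∈ F, x e ≤ prExists p F)

/-- Total weight `∑_{e ∈ F} w_e x_e` of a fractional solution on the edge set `F`. -/
def value (F : Finset (V × B)) (w x : V × B → ℝ) : ℝ := ∑ e ∈ F, w e * x e

/-- Optimal solutions of the linear program. -/
def LPOptimal (E : Finset (V × B)) (p w x : V × B → ℝ) : Prop :=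
  LPFeasible E p x ∧ ∀ y, LPFeasible E p y → value E w y ≤ value E w x

open Classical in
/-- Maximum weight of a matching contained in `R`. -/
def maxWeight (w : V × B → ℝ) (R : Finset (V × B)) : ℝ :=
  (R.powerset.filter IsMatching).sup'
    ⟨∅, Finset.mem_filter.2 ⟨Finset.empty_mem_powerset R, fun e he => absurd he (by simp)⟩⟩
    (fun M => ∑ e ∈ M, w e)

/-- `OPT`: expected maximum weight of a matching in the realized subgraph; the realized edge set
is `R ⊆ E` with probability `∏_{e ∈ R} p_e ∏_{e ∈ E \ R} (1 - p_e)`. -/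
def opt (E : Finset (V × B)) (p w : V × B → ℝ) : ℝ :=
  ∑ R ∈ E.powerset, (∏ e ∈ R, p e) * (∏ e ∈ E \ R, (1 - p e)) * maxWeight w R

/-- Edges with `g(x_e, 1) / p_e ≥ τ`. -/
def heavyEdges (E : Finset (V × B)) (p x : V × B → ℝ) (τ : ℝ) : Finset (V × B) :=
  {e ∈ E | τ ≤ g (x e) 1 / p e}

/-- `E^(τ)`: edges with `g(x_e, 1) / p_e ≤ τ`. -/
def lightEdges (E : Finset (V × B)) (p x : V × B → ℝ) (τ : ℝ) : Finset (V × B) :=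
  {e ∈ E | g (x e) 1 / p e ≤ τ}

end Graph

/-! ### Random choices -/

/-- A coin that shows `true` with probability `q` (for `0 ≤ q ≤ 1`). -/
def coin (q : ℝ) : PMF Bool :=
  PMF.ofFintype
    (fun b => if b then min (ENNReal.ofReal q) 1 else 1 - min (ENNReal.ofReal q) 1)
    (by simp)

/-- The three things that can happen to an edge when a permutation is thinned. -/
inductive Act
  | halt
  | keep
  | skip
  deriving DecidableEq

instance : MeasurableSpace Act := ⊤

instance : MeasurableSingletonClass Act := ⟨fun _ => trivial⟩

instance : Countable Act :=
  Function.Injective.countable (f := fun a : Act => (match a with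
    | .halt => 0 | .keep => 1 | .skip => 2 : ℕ)) (by intro a b; cases a <;> cases b <;> simp)

/-- What happens for the value `c` of the random number, for an edge with existence probability
`q` and ratio `r = x̃_e / x_e`. -/
def actOf (q r c : ℝ) : Act :=
  if c ≤ q * (1 - r) then .halt else if c ≤ q * (1 - r) + r then .keep else .skip

lemma measurable_actOf (q r : ℝ) : Measurable (actOf q r) :=
  Measurable.ite measurableSet_Iic measurable_const
    (Measurable.ite measurableSet_Iic measurable_const measurable_const)

/-- The uniform distribution on `[0,1]`. -/
def uniform01 : Measure ℝ := volume.restrict (Set.Icc 0 1)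

instance : IsProbabilityMeasure uniform01 := ⟨by simp [uniform01]⟩

instance (q r : ℝ) : IsProbabilityMeasure (uniform01.map (actOf q r)) :=
  Measure.isProbabilityMeasure_map (measurable_actOf q r).aemeasurable

/-- Law of the action, for `c` uniform on `[0,1]`. -/
def drawAct (q r : ℝ) : PMF Act := (uniform01.map (actOf q r)).toPMF

/-- Expectation under a distribution on a finite type. -/
def expect {α : Type*} [Fintype α] (P : PMF α) (f : α → ℝ) : ℝ := ∑ a, (P a).toReal * f a

/-! ### The algorithm

The edges at a vertex `v` on the left are named by their end-point in `B`, so a permutation of a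
subset of `E_v` is a duplicate-free list of neighbours of `v`. -/

section Vertex

variable {B : Type*}

/-- Examine the edges in the order of the list, each being realized independently with its
probability `q u`, and output the first realized one (if any). -/
def firstRealized (q : B → ℝ) : List B → PMF (Option B)
  | [] => PMF.pure none
  | u :: l => (coin (q u)).bind fun b => if b then PMF.pure (some u) else firstRealized q l

/-- Thinning of a permutation: `q` are the existence probabilities, `r` the ratios `x̃_e / x_e`. -/
def thin (q r : B → ℝ) : List B → PMF (List B)
  | [] => PMF.pure []
  | u :: l => (drawAct (q u) (r u)).bind fun a =>
      match a with
      | .halt => PMF.pure []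
      | .keep => (thin q r l).map (u :: ·)
      | .skip => thin q r l

end Vertex

section Run

variable {V B : Type*} [DecidableEq V] [DecidableEq B]

/-- `D` is a distribution over permutations of subsets of `E_v` that is proportional to `x`: each
edge `(v,u)` of `E` is the first realized one with probability exactly `x (v,u)`. -/
def IsProportional (E : Finset (V × B)) (p x : V × B → ℝ) (v : V) (D : PMF (List B)) : Prop :=
  (∀ l ∈ D.support, l.Nodup ∧ ∀ u ∈ l, (v, u) ∈ E) ∧
  ∀ u, (v, u) ∈ E →
    (D.bind (firstRealized fun u' => p (v, u'))) (some u) = ENNReal.ofReal (x (v, u))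

/-- The proposal of `v`: draw a permutation from `D`, thin it with the ratios `x̃_e / x_e`, examine
the edges of the thinned permutation in order and propose along the first realized one. -/
def proposal (p x xt : V × B → ℝ) (D : PMF (List B)) (v : V) : PMF (Option B) :=
  (D.bind (thin (fun u => p (v, u)) (fun u => xt (v, u) / x (v, u)))).bind
    (firstRealized fun u => p (v, u))

/-- A vertex `u` of `B` accepts the proposal of `v` iff `u` is unmatched. -/
def respond (M : Finset (V × B)) (v : V) : Option B → Finset (V × B)
  | none => M
  | some u => if ∀ e ∈ M, e.2 ≠ u then insert (v, u) M else M

/-- The vertices in the list make their proposals one after the other. -/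
def runList (prop : V → PMF (Option B)) : List V → Finset (V × B) → PMF (Finset (V × B))
  | [], M => PMF.pure M
  | v :: L, M => (prop v).bind fun o => runList prop L (respond M v o)

/-- The vertices make their proposals in a uniformly random order. -/
def runRandom [Fintype V] (prop : V → PMF (Option B)) : PMF (Finset (V × B)) :=
  (PMF.uniformOfFintype (Equiv.Perm V)).bind fun π =>
    runList prop ((Finset.univ : Finset V).toList.map π) ∅

end Run

/-! Dummy edges: one new vertex on the left for each `u` in `B`, joined to `u` only. -/

section Dummy

variable {A B : Type*} [DecidableEq A] [DecidableEq B]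

/-- The edges of `F` together with the dummy edges. -/
def extEdges [Fintype B] (F : Finset (A × B)) : Finset ((A ⊕ B) × B) :=
  F.image (fun e => (Sum.inl e.1, e.2)) ∪ Finset.univ.image (fun u : B => (Sum.inr u, u))

/-- The dummy edge at `u` has `x_e = σ - ∑_{e ∈ F, e ∋ u} x_e`. -/
def extX (F : Finset (A × B)) (x : A × B → ℝ) (σ : ℝ) : (A ⊕ B) × B → ℝ
  | (Sum.inl a, u) => x (a, u)
  | (Sum.inr _, u) => σ - ∑ e ∈ F with e.2 = u, x e

/-- Dummy edges have `p_e = 1`. -/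
def extP (p : A × B → ℝ) : (A ⊕ B) × B → ℝ
  | (Sum.inl a, u) => p (a, u)
  | (Sum.inr _, _) => 1

/-- Dummy edges have `w_e = 0`. -/
def extW (w : A × B → ℝ) : (A ⊕ B) × B → ℝ
  | (Sum.inl a, u) => w (a, u)
  | (Sum.inr _, _) => 0

/-- `D` is a choice, for every left vertex of the graph `F` with its dummy edges, of a distribution
proportional to the (extended) solution `x`. -/
def IsProportionalFamily [Fintype B] (F : Finset (A × B)) (p x : A × B → ℝ) (σ : ℝ)
    (D : A ⊕ B → PMF (List B)) : Prop :=
  ∀ v, IsProportional (extEdges F) (extP p) (extX F x σ) v (D v)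

/-- The law of the matching returned by the algorithm on the edge set `F` with parameter `σ`, when
it uses the proportional distributions `D`. -/
def alg1 [Fintype A] [Fintype B] (F : Finset (A × B)) (p x : A × B → ℝ) (σ : ℝ)
    (D : A ⊕ B → PMF (List B)) : PMF (Finset ((A ⊕ B) × B)) :=
  runRandom fun v =>
    proposal (extP p) (extX F x σ) (fun e => g (extX F x σ e) σ) (D v) v

/-- Weight of a matching of the extended graph. -/
def weight (w : A × B → ℝ) (M : Finset ((A ⊕ B) × B)) : ℝ := ∑ e ∈ M, extW w e

end Dummy

end StochMatch

end

noncomputable section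

namespace StochMatch

/-! ### The transformation function -/

/-! Fix `u` in `B` and write `X v` for the fractional value of the edge from `v` to `u`; the dummy
edge makes these values add up to exactly `σ = ρ(τ)`. Thinning turns "first realized with
probability `X v`" into "proposed with probability `g (X v) σ`" (`thin_bind_firstRealized`,
`proposal_apply`), and different left vertices propose independently. As `u` takes its first
proposal, `(v,u)` is matched iff `v` proposes to `u` and no earlier vertex does. In terms of uniform
arrival times this has probability `g (X v) σ * ∫₀¹ ∏_{v' ≠ v} (1 - t * g (X v') σ) dt`.

If every factor `1 - t * g (X v') σ` were the survival probability `exp (-t * X v')` of an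
exponential clock, the integral would depend only on `σ - X v`, and `g` is the function for which
the result is `(1 - exp (-σ)) / σ * X v` (`g_mul_integral_exp`). Replacing the exponentials by the
true factors does not decrease the integral (`integral_exp_le_integral_prod`): the difference `1 - t
* g - exp (-t * X)` is concave, vanishes at `0` and has nonnegative integral, hence passes from
positive to negative at most once, and the remaining factors are decreasing weights. The nonnegative
integral is the analytic inequality `g_le_of_pos`.

Heaviness serves to make `σ = ρ(τ)` admissible: it gives `x ≤ φ` and `p ≤ x / τ`, so by Bernoulli's
inequality the LP constraint at a vertex becomes the inequality that defines `ρ(τ)` (`sum_le_rho`).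
Proportional distributions exist because the LP constraints at a left vertex describe a polymatroid
whose linear functionals are maximized greedily (`exists_list_sum_le`). Finally, the LP bounds `OPT`
from above (`opt_le_value`), and an optimal solution puts no mass on edges of negative weight. -/

lemma exp_le_quartic {x : ℝ} (h0 : 0 ≤ x) (h1 : x ≤ 1) :
    Real.exp x ≤ 1 + x + x ^ 2 / 2 + x ^ 3 / 6 + 5 / 96 * x ^ 4 := by
  -- With four terms the remainder coefficient is `(4 + 1) / (4! * 4) = 5 / 96`.
  have h := Real.exp_bound' h0 h1 (n := 4) (by norm_num)
  norm_num [Finset.sum_range_succ, Nat.factorial] at h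
  linarith

lemma cubic_le_exp {x : ℝ} (h0 : 0 ≤ x) : 1 + x + x ^ 2 / 2 + x ^ 3 / 6 ≤ Real.exp x := by
  have h := Real.sum_le_exp_of_nonneg h0 4
  norm_num [Finset.sum_range_succ, Nat.factorial] at h
  linarith

lemma g_of_lt {x σ : ℝ} (h : x < σ) :
    g x σ = (Real.exp σ - 1) * (σ - x) * x / (σ * (Real.exp σ - Real.exp x)) := by
  simp [g, h.ne]

lemma g_self (σ : ℝ) : g σ σ = 1 - Real.exp (-σ) := by simp [g]

lemma g_zero {σ : ℝ} (hσ : 0 < σ) : g 0 σ = 0 := by simp [g, hσ.ne]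

lemma g_nonneg {x σ : ℝ} (h0 : 0 ≤ x) (h : x ≤ σ) : 0 ≤ g x σ := by
  rcases h.eq_or_lt with rfl | h
  · rw [g_self]; have := Real.exp_le_one_iff.2 (neg_nonpos.2 h0); linarith
  · rw [g_of_lt h]
    have h1 : Real.exp x < Real.exp σ := Real.exp_lt_exp.2 h
    have h2 : 1 ≤ Real.exp σ := Real.one_le_exp (h0.trans h.le)
    have h3 : 0 ≤ σ := h0.trans h.le
    apply div_nonneg
    · exact mul_nonneg (mul_nonneg (by linarith) (by linarith)) h0
    · exact mul_nonneg h3 (by linarith)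

/-- Cleared of denominators, this says that `exp` lies below its chord over `[0, σ]`. -/
lemma g_le_self {x σ : ℝ} (h0 : 0 ≤ x) (h : x ≤ σ) (hσ : 0 < σ) : g x σ ≤ x := by
  rcases h.eq_or_lt with rfl | h
  · rw [g_self]; linarith [Real.add_one_le_exp (-x)]
  · rw [g_of_lt h]
    have h1 : Real.exp x < Real.exp σ := Real.exp_lt_exp.2 h
    rw [div_le_iff₀ (mul_pos hσ (by linarith))]
    rcases h0.eq_or_lt with rfl | h0
    · simp
    have h2 := strictConvexOn_exp.secant_strict_mono_aux1 (Set.mem_univ 0) (Set.mem_univ σ) h0 h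
    rw [Real.exp_zero] at h2
    nlinarith

/-- The polynomial core of `g_le_of_pos`, with `D = σ - x`: `exp x` has been replaced by its quartic
upper bound, `(exp D - 1) / D` by `1 + D/2 + D²/6`, and a common factor `x ^ 3` cancelled. -/
lemma g_polynomial_bound {x D : ℝ} (hx : 0 ≤ x) (hD : 0 ≤ D) (h : x + D ≤ 1) :
    1 + x / 2 + x ^ 2 / 6 + 5 / 96 * x ^ 3 ≤
      (1 + D / 2 + D ^ 2 / 6) * (1 + 2 / 3 * x + 11 / 48 * x ^ 2 + 5 / 48 * x ^ 3 -
        D * (1 / 3 + 13 / 48 * x + 3 / 48 * x ^ 2 + 5 / 96 * x ^ 3)) := by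
  have h1 : 0 ≤ 1 - x - D := by linarith
  nlinarith [mul_nonneg hx hD, mul_nonneg hx h1, mul_nonneg hD h1,
    mul_nonneg (mul_nonneg hx hD) h1, pow_nonneg hx 2, pow_nonneg hx 3, pow_nonneg hD 2,
    pow_nonneg hD 3, mul_nonneg (pow_nonneg hx 2) hD, mul_nonneg (pow_nonneg hD 2) hx,
    mul_nonneg (pow_nonneg hD 2) h1]

/-- The bound is equivalent to `∫₀¹ (1 - t * g x σ - exp (-t * x)) dt ≥ 0`, the only quantitative
fact needed in the comparison with exponential clocks. -/
lemma g_le_of_pos {x σ : ℝ} (h0 : 0 < x) (h : x ≤ σ) (hσ : σ ≤ 1) :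
    g x σ ≤ 2 * (1 - (1 - Real.exp (-x)) / x) := by
  have ha := exp_le_quartic h0.le (h.trans hσ)
  have hapos := Real.exp_pos x
  set a := Real.exp x with ha'
  have hR : 2 * (1 - (1 - Real.exp (-x)) / x) = 2 * (1 - (1 - x) * a) / (x * a) := by
    rw [Real.exp_neg, ← ha']; field_simp; ring
  rw [hR]
  rcases h.eq_or_lt with rfl | h
  · rw [g_self, Real.exp_neg, ← ha']
    have : 1 - a⁻¹ = (a - 1) * x / (x * a) := by field_simp
    rw [this]
    refine div_le_div_of_nonneg_right ?_ (by positivity)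
    -- For `x = σ` the claim is the Padé bound `(2 - x) * exp x ≤ 2 + x`.
    have h2 : (2 - x) * a ≤ (2 - x) * (1 + x + x ^ 2 / 2 + x ^ 3 / 6 + 5 / 96 * x ^ 4) := by
      gcongr; linarith
    have h3 : x ^ 3 * x ≤ x ^ 3 * 1 := by gcongr
    have h4 : 0 < x ^ 5 := by positivity
    have h5 : 0 < x ^ 3 := by positivity
    nlinarith
  · obtain ⟨D, rfl⟩ : ∃ D, σ = x + D := ⟨σ - x, by ring⟩
    have hD : 0 < D := by linarith
    rw [g_of_lt h, Real.exp_add, ← ha']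
    have hZ := cubic_le_exp hD.le
    set b := Real.exp D
    have hb : 0 < b - 1 := by nlinarith [pow_pos hD 2, pow_pos hD 3]
    have key := g_polynomial_bound h0.le hD.le hσ
    have e : x ^ 2 * (a - 1) ≤ (1 + D / 2 + D ^ 2 / 6) *
        (2 * (1 - (1 - x) * a) * (x + D) - a * D * x ^ 2) := by
      have h1 : (x ^ 2 + (1 + D / 2 + D ^ 2 / 6) * (2 * (1 - x) * (x + D) + D * x ^ 2)) * a ≤
          (x ^ 2 + (1 + D / 2 + D ^ 2 / 6) * (2 * (1 - x) * (x + D) + D * x ^ 2)) *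
          (1 + x + x ^ 2 / 2 + x ^ 3 / 6 + 5 / 96 * x ^ 4) := by
        have : 0 ≤ 1 - x := by linarith
        gcongr
      have h2 := mul_le_mul_of_nonneg_left key (pow_pos h0 3).le
      linear_combination h1 + h2
    -- The sign matters because this factor is next multiplied by `b - 1` in place of the smaller `D
    -- + D²/2 + D³/6`.
    have hpos : 0 ≤ 2 * (1 - (1 - x) * a) * (x + D) - a * D * x ^ 2 := by
      by_contra hneg
      have h1 : 1 ≤ a := Real.one_le_exp h0.le
      have h2 : 0 ≤ x ^ 2 * (a - 1) := mul_nonneg (by positivity) (by linarith)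
      have h3 := mul_neg_of_pos_of_neg (show 0 < 1 + D / 2 + D ^ 2 / 6 by positivity)
        (not_le.1 hneg)
      linarith
    have e2 : D * (x ^ 2 * (a - 1)) ≤
        (b - 1) * (2 * (1 - (1 - x) * a) * (x + D) - a * D * x ^ 2) :=
      calc _ ≤ D * ((1 + D / 2 + D ^ 2 / 6) *
          (2 * (1 - (1 - x) * a) * (x + D) - a * D * x ^ 2)) := by gcongr
        _ = (D + D ^ 2 / 2 + D ^ 3 / 6) *
          (2 * (1 - (1 - x) * a) * (x + D) - a * D * x ^ 2) := by ring
        _ ≤ _ := by gcongr; linarith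
    have hab : 0 < a * b - a := by nlinarith
    rw [div_le_div_iff₀ (by positivity) (by positivity)]
    have e3 := mul_le_mul_of_nonneg_left e2 hapos.le
    linear_combination e3

/-! ### The thresholds `φ(τ)` and `ρ(τ)` -/

/-- The denominator is the secant slope of `exp` between `x` and `1`, which increases with `x` by
convexity; this is the source of the monotonicity below. At `x = 1` the tangent slope `exp 1` takes
its place. -/
lemma g_one_div {x : ℝ} (h0 : 0 < x) (h : x < 1) :
    g x 1 / x = (Real.exp 1 - 1) / ((Real.exp 1 - Real.exp x) / (1 - x)) := by
  have h1 : Real.exp x < Real.exp 1 := Real.exp_lt_exp.2 h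
  have h2 : 0 < Real.exp 1 - Real.exp x := by linarith
  have h3 : 0 < 1 - x := by linarith
  rw [g_of_lt h]
  field_simp

lemma g_one_div_strictAnti {x y : ℝ} (h0 : 0 < x) (hxy : x < y) (hy : y ≤ 1) :
    g y 1 / y < g x 1 / x := by
  have hx1 : x < 1 := hxy.trans_le hy
  have h1 : Real.exp x < Real.exp 1 := Real.exp_lt_exp.2 hx1
  have he : 1 < Real.exp 1 := Real.one_lt_exp_iff.2 one_pos
  have hs : 0 < (Real.exp 1 - Real.exp x) / (1 - x) := div_pos (by linarith) (by linarith)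
  rw [g_one_div h0 hx1]
  rcases hy.eq_or_lt with rfl | hy
  · rw [g_self, div_one, lt_div_iff₀ hs, Real.exp_neg]
    have h2 : (Real.exp 1 - Real.exp x) / (1 - x) < Real.exp 1 := by
      rw [div_lt_iff₀ (by linarith)]
      have h3 := Real.add_one_lt_exp (show x - 1 ≠ 0 by linarith)
      have h4 : Real.exp x = Real.exp (x - 1) * Real.exp 1 := by rw [← Real.exp_add]; simp
      nlinarith
    have h5 : 0 < 1 - (Real.exp 1)⁻¹ := by
      have := inv_lt_one_of_one_lt₀ he; linarith
    calc _ < (1 - (Real.exp 1)⁻¹) * Real.exp 1 := by gcongr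
      _ = _ := by field_simp
  · rw [g_one_div (h0.trans hxy) hy]
    have h2 := strictConvexOn_exp.secant_strict_mono_aux3 (Set.mem_univ x) (Set.mem_univ 1) hxy hy
    have h3 : 0 < Real.exp 1 - 1 := by linarith
    gcongr

/-- Near `0` the ratio is close to `1 > τ`, which keeps the infimum of `phiSet τ` away from `0`. -/
lemma one_sub_le_g_one_div {x : ℝ} (h0 : 0 < x) (h : x < 1) : 1 - x ≤ g x 1 / x := by
  have h1 : Real.exp x < Real.exp 1 := Real.exp_lt_exp.2 h
  have h2 : 1 < Real.exp x := Real.one_lt_exp_iff.2 h0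
  rw [g_one_div h0 h, div_div_eq_mul_div, le_div_iff₀ (by linarith), mul_comm]
  gcongr

lemma mem_phiSet_of_le {x τ : ℝ} (h0 : 0 < x) (h1 : x ≤ 1) (h : g x 1 / x ≤ τ) :
    x ∈ phiSet τ := by
  refine ⟨⟨h0, h1⟩, fun y hy => ?_⟩
  rcases hy.1.eq_or_lt with rfl | hxy
  · exact h
  · exact (g_one_div_strictAnti h0 hxy hy.2).le.trans h

/-- A convenient numerical witness: it yields `φ(τ) ≤ 7/10 < 3/4 ≤ τ`, so that the base `1 - φ/τ` in
the definition of `ρ` is positive. -/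
lemma seven_tenths_mem_phiSet {τ : ℝ} (hτ : 3 / 4 ≤ τ) : (7 / 10 : ℝ) ∈ phiSet τ := by
  refine mem_phiSet_of_le (by norm_num) (by norm_num) (le_trans ?_ hτ)
  have h1 := exp_le_quartic (x := 7 / 10) (by norm_num) (by norm_num)
  have h2 := Real.exp_one_gt_d9
  rw [g_one_div (by norm_num) (by norm_num), div_div_eq_mul_div, div_le_iff₀ (by linarith)]
  linarith

lemma isLeast_phi {τ : ℝ} (hτ : 3 / 4 ≤ τ) (hτ' : τ < 1) : IsLeast (phiSet τ) (phi τ) := by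
  have hne : (phiSet τ).Nonempty := ⟨_, seven_tenths_mem_phiSet hτ⟩
  have hbdd : BddBelow (phiSet τ) := ⟨0, fun x hx => hx.1.1.le⟩
  refine ⟨?_, fun x hx => csInf_le hbdd hx⟩
  have hpos : 0 < phi τ := by
    -- At the test point `(1 - τ) / 2` the ratio is at least `(1 + τ) / 2 > τ`.
    refine lt_of_lt_of_le (show 0 < (1 - τ) / 2 by linarith) (le_csInf hne fun s hs => ?_)
    by_contra hlt
    have h1 := hs.2 ((1 - τ) / 2) ⟨(not_le.1 hlt).le, by linarith⟩
    have h2 := one_sub_le_g_one_div (x := (1 - τ) / 2) (by linarith) (by linarith)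
    linarith
  have hle : phi τ ≤ 7 / 10 := csInf_le hbdd (seven_tenths_mem_phiSet hτ)
  refine mem_phiSet_of_le hpos (by linarith) ?_
  have hcont : ContinuousAt (fun x => g x 1 / x) (phi τ) := by
    have : ContinuousAt
        (fun x => (Real.exp 1 - 1) / ((Real.exp 1 - Real.exp x) / (1 - x))) (phi τ) := by
      have h1 : Real.exp (phi τ) < Real.exp 1 := Real.exp_lt_exp.2 (by linarith)
      have h3 : 1 - phi τ ≠ 0 := by linarith
      have h4 : (Real.exp 1 - Real.exp (phi τ)) / (1 - phi τ) ≠ 0 :=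
        div_ne_zero (by linarith) h3
      fun_prop (disch := assumption)
    refine this.congr ?_
    filter_upwards [Ioo_mem_nhds hpos (show phi τ < 1 by linarith)] with x hx
    exact (g_one_div hx.1 hx.2).symm
  refine le_of_tendsto (hcont.tendsto.mono_left (nhdsWithin_le_nhds (s := Set.Ioi (phi τ)))) ?_
  filter_upwards [Ioo_mem_nhdsGT (show phi τ < 1 by linarith)] with x hx
  obtain ⟨s, hs, hsx⟩ := exists_lt_of_csInf_lt hne hx.1
  exact hs.2 x ⟨hsx.le, hx.2.le⟩

lemma phi_pos {τ : ℝ} (hτ : 3 / 4 ≤ τ) (hτ' : τ < 1) : 0 < phi τ := (isLeast_phi hτ hτ').1.1.1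

lemma phi_le {τ : ℝ} (hτ : 3 / 4 ≤ τ) (hτ' : τ < 1) : phi τ ≤ 7 / 10 :=
  (isLeast_phi hτ hτ').2 (seven_tenths_mem_phiSet hτ)

lemma one_sub_phi_div_pos {τ : ℝ} (hτ : 3 / 4 ≤ τ) (hτ' : τ < 1) : 0 < 1 - phi τ / τ := by
  have := phi_le hτ hτ'
  rw [sub_pos, div_lt_one (by linarith)]
  linarith

/-- `φ` itself satisfies the inequality, which there reads `φ ≤ φ / τ`. So the search can be
restricted to the compact interval `[φ, 1]`, where a closed condition has a largest solution. -/
lemma isGreatest_rho {τ : ℝ} (hτ : 3 / 4 ≤ τ) (hτ' : τ < 1) :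
    IsGreatest (rhoSet τ) (rho τ) := by
  have hφ := phi_pos hτ hτ'
  have hφ' := phi_le hτ hτ'
  have hb := one_sub_phi_div_pos hτ hτ'
  have hcont : Continuous fun x : ℝ => 1 - (1 - phi τ / τ) ^ (x / phi τ) :=
    continuous_const.sub
      ((Real.continuous_const_rpow hb.ne').comp (continuous_id.div_const _))
  have hK : IsCompact (Set.Icc (phi τ) 1 ∩ {x | x ≤ 1 - (1 - phi τ / τ) ^ (x / phi τ)}) :=
    isCompact_Icc.inter_right (isClosed_le continuous_id hcont)
  have hφmem : phi τ ∈ Set.Icc (phi τ) 1 ∩ {x | x ≤ 1 - (1 - phi τ / τ) ^ (x / phi τ)} := by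
    refine ⟨⟨le_rfl, by linarith⟩, ?_⟩
    simp only [Set.mem_ofPred_eq, div_self hφ.ne', Real.rpow_one, sub_sub_cancel]
    rw [le_div_iff₀ (by linarith)]
    nlinarith
  obtain ⟨m, hm, hmax⟩ := hK.exists_isGreatest ⟨_, hφmem⟩
  have hgr : IsGreatest (rhoSet τ) m := by
    refine ⟨⟨⟨hφ.trans_le hm.1.1, hm.1.2⟩, hm.2⟩, fun x hx => ?_⟩
    rcases le_total x (phi τ) with h | h
    · exact h.trans hm.1.1
    · exact hmax ⟨⟨h, hx.1.2⟩, hx.2⟩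
  rw [rho, hgr.csSup_eq]
  exact hgr

lemma rho_lt_one {τ : ℝ} (hτ : 3 / 4 ≤ τ) (hτ' : τ < 1) : rho τ < 1 := by
  have h1 := (isGreatest_rho hτ hτ').1.2
  have h2 := Real.rpow_pos_of_pos (one_sub_phi_div_pos hτ hτ') (rho τ / phi τ)
  linarith

lemma rho_pos {τ : ℝ} (hτ : 3 / 4 ≤ τ) (hτ' : τ < 1) : 0 < rho τ :=
  (isGreatest_rho hτ hτ').1.1.1

/-- Strict monotonicity of the ratio forces `x ≤ φ`, even for edges with equality in the heaviness
condition, and `g x 1 ≤ x` forces `p ≤ x / τ`. Bernoulli's inequality with exponent `x / φ ≤ 1` then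
bounds the power by `1 - x / τ`. -/
lemma one_sub_le_of_heavy {τ p x : ℝ} (hτ : 3 / 4 ≤ τ) (hτ' : τ < 1) (hx : 0 < x) (hxp : x ≤ p)
    (hp : p ≤ 1) (h : τ ≤ g x 1 / p) : (1 - phi τ / τ) ^ (x / phi τ) ≤ 1 - p := by
  have hφ := phi_pos hτ hτ'
  have hg := g_nonneg hx.le (hxp.trans hp)
  have hxφ : x ≤ phi τ := by
    by_contra hlt
    have h1 := g_one_div_strictAnti hφ (not_le.1 hlt) (hxp.trans hp)
    have h2 := (isLeast_phi hτ hτ').1.2 (phi τ) ⟨le_rfl, (isLeast_phi hτ hτ').1.1.2⟩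
    have h3 : g x 1 / p ≤ g x 1 / x := by gcongr
    linarith
  have hpx : p ≤ x / τ := by
    rw [le_div_iff₀ (hx.trans_le hxp)] at h
    rw [le_div_iff₀ (by linarith)]
    linarith [g_le_self hx.le (hxp.trans hp) one_pos]
  have hB := rpow_one_add_le_one_add_mul_self (s := -(phi τ / τ))
    (by linarith [one_sub_phi_div_pos hτ hτ']) (p := x / phi τ) (by positivity)
    ((div_le_one hφ).2 hxφ)
  rw [← sub_eq_add_neg] at hB
  have : x / phi τ * -(phi τ / τ) = -(x / τ) := by field_simp
  linarith

/-- In the product of the bounds for single edges the exponents add up, so the sum itself belongs to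
`rhoSet τ`. -/
lemma sum_le_rho {ι : Type*} {τ : ℝ} (hτ : 3 / 4 ≤ τ) (hτ' : τ < 1) (F : Finset ι) (p x : ι → ℝ)
    (hx : ∀ e ∈ F, 0 < x e) (hxp : ∀ e ∈ F, x e ≤ p e) (hp : ∀ e ∈ F, p e ≤ 1)
    (h : ∀ e ∈ F, τ ≤ g (x e) 1 / p e) (hF : ∑ e ∈ F, x e ≤ 1 - ∏ e ∈ F, (1 - p e)) :
    ∑ e ∈ F, x e ≤ rho τ := by
  rcases F.eq_empty_or_nonempty with rfl | hne
  · simpa using (rho_pos hτ hτ').le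
  have hb := one_sub_phi_div_pos hτ hτ'
  refine (isGreatest_rho hτ hτ').2 ⟨⟨Finset.sum_pos hx hne, ?_⟩, ?_⟩
  · have := Finset.prod_nonneg (s := F) (f := fun e => 1 - p e)
      fun e he => sub_nonneg.2 (hp e he)
    linarith
  · refine hF.trans (sub_le_sub_left ?_ 1)
    rw [Finset.sum_div, Real.rpow_sum_of_pos hb]
    exact Finset.prod_le_prod (fun e _ => Real.rpow_nonneg hb.le _)
      fun e he => one_sub_le_of_heavy hτ hτ' (hx e he) (hxp e he) (hp e he) (h e he)

/-! ### Comparison with independent exponential clocks -/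

lemma integral_exp_neg_mul {x : ℝ} (hx : x ≠ 0) :
    ∫ t in (0 : ℝ)..1, Real.exp (-(t * x)) = (1 - Real.exp (-x)) / x := by
  have h : ∀ t ∈ Set.uIcc (0 : ℝ) 1,
      HasDerivAt (fun t => -Real.exp (-(t * x)) / x) (Real.exp (-(t * x))) t := by
    intro t _
    have h1 : HasDerivAt (fun t => -(t * x)) (-(1 * x)) t := ((hasDerivAt_id t).mul_const x).neg
    convert! (h1.exp.neg.div_const x) using 1
    field_simp
  rw [intervalIntegral.integral_eq_sub_of_hasDerivAt h
    (Continuous.intervalIntegrable (by fun_prop) _ _)]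
  simp
  ring

lemma integral_linear_sub_exp_nonneg {x σ : ℝ} (h0 : 0 ≤ x) (h : x ≤ σ) (hσ : 0 < σ)
    (hσ1 : σ ≤ 1) :
    0 ≤ ∫ t in (0 : ℝ)..1, (1 - t * g x σ - Real.exp (-(t * x))) := by
  rcases h0.eq_or_lt with rfl | h0
  · simp [g_zero hσ]
  · have hI : ∫ t in (0 : ℝ)..1, (1 - t * g x σ - Real.exp (-(t * x))) =
        1 - g x σ / 2 - (1 - Real.exp (-x)) / x := by
      rw [intervalIntegral.integral_sub (Continuous.intervalIntegrable (by fun_prop) _ _)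
        (Continuous.intervalIntegrable (by fun_prop) _ _), integral_exp_neg_mul h0.ne',
        intervalIntegral.integral_sub (Continuous.intervalIntegrable (by fun_prop) _ _)
        (Continuous.intervalIntegrable (by fun_prop) _ _), intervalIntegral.integral_mul_const,
        integral_id]
      simp
      ring
    rw [hI]
    linarith [g_le_of_pos h0 h hσ1]

lemma concaveOn_linear_sub_exp (c x : ℝ) :
    ConcaveOn ℝ Set.univ fun t : ℝ => 1 - t * c - Real.exp (-(t * x)) := by
  refine ⟨convex_univ, fun t _ s _ a b ha hb hab => ?_⟩
  have h := convexOn_exp.2 (Set.mem_univ (-(t * x))) (Set.mem_univ (-(s * x))) ha hb hab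
  simp only [smul_eq_mul] at h ⊢
  have e : a * -(t * x) + b * -(s * x) = -((a * t + b * s) * x) := by ring
  rw [e] at h
  have : a = 1 - b := by linarith
  subst this
  linear_combination h

/-- A function that starts at `0`, is concave and has a nonnegative integral keeps a nonnegative
integral when multiplied by a decreasing weight. -/
lemma integral_mul_nonneg_of_concaveOn {P f : ℝ → ℝ} (hP : AntitoneOn P (Set.Icc 0 1))
    (hP0 : ∀ t ∈ Set.Icc (0 : ℝ) 1, 0 ≤ P t) (hPc : Continuous P) (hf : ConcaveOn ℝ Set.univ f)
    (hf0 : f 0 = 0) (hfc : Continuous f) (hint : 0 ≤ ∫ t in (0 : ℝ)..1, f t) :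
    0 ≤ ∫ t in (0 : ℝ)..1, P t * f t := by
  -- Concavity and `f 0 = 0` make `{f ≥ 0}` an initial segment, so `f` changes sign at most once, at
  -- `t₀`.
  have hdown : ∀ t s : ℝ, 0 ≤ t → t ≤ s → 0 ≤ f s → 0 ≤ f t := by
    intro t s ht hts hs
    rcases ht.eq_or_lt with rfl | ht
    · exact hf0.ge
    have hs0 : 0 < s := ht.trans_le hts
    have h := hf.2 (Set.mem_univ 0) (Set.mem_univ s) 
      (sub_nonneg.2 ((div_le_one hs0).2 hts)) (div_nonneg ht.le hs0.le) (sub_add_cancel 1 (t / s))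
    simp only [smul_eq_mul, hf0, mul_zero, zero_add, div_mul_cancel₀ _ hs0.ne'] at h
    exact le_trans (by positivity) h
  obtain ⟨t₀, ht₀, hle, hge⟩ : ∃ t₀ ∈ Set.Icc (0 : ℝ) 1,
      (∀ t ∈ Set.Icc (0 : ℝ) 1, t < t₀ → 0 ≤ f t) ∧
      (∀ t ∈ Set.Icc (0 : ℝ) 1, t₀ < t → f t ≤ 0) := by
    let A : Set ℝ := {t | t ∈ Set.Icc (0 : ℝ) 1 ∧ 0 ≤ f t}
    have hA0 : (0 : ℝ) ∈ A := ⟨⟨le_rfl, zero_le_one⟩, hf0.ge⟩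
    have hAb : BddAbove A := ⟨1, fun t ht => ht.1.2⟩
    refine ⟨sSup A, ⟨le_csSup hAb hA0, csSup_le ⟨0, hA0⟩ fun t ht => ht.1.2⟩, ?_, ?_⟩
    · intro t ht hlt
      obtain ⟨s, hs, hts⟩ := exists_lt_of_lt_csSup ⟨0, hA0⟩ hlt
      exact hdown t s ht.1 hts.le hs.2
    · intro t ht hlt
      by_contra hneg
      exact absurd (le_csSup hAb (show t ∈ A from ⟨ht, (not_le.1 hneg).le⟩)) (not_le.2 hlt)
  -- On both sides of `t₀`, replacing the weight `P t` by `P t₀` can only lower the integrand.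
  calc 0 ≤ P t₀ * ∫ t in (0 : ℝ)..1, f t := mul_nonneg (hP0 _ ht₀) hint
    _ = ∫ t in (0 : ℝ)..1, P t₀ * f t := (intervalIntegral.integral_const_mul _ _).symm
    _ ≤ ∫ t in (0 : ℝ)..1, P t * f t := by
      refine intervalIntegral.integral_mono_on zero_le_one
        (Continuous.intervalIntegrable (by fun_prop) _ _)
        (Continuous.intervalIntegrable (by fun_prop) _ _) fun t ht => ?_
      rcases lt_trichotomy t t₀ with h | rfl | h
      · exact mul_le_mul_of_nonneg_right (hP ht ht₀ h.le) (hle t ht h)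
      · rfl
      · exact mul_le_mul_of_nonpos_right (hP ht₀ ht h.le) (hge t ht h)

/-- The factors are exchanged one at a time; `s` collects the values whose factors are still
exponential, which is why the induction generalizes over it. -/
lemma integral_exp_le_integral_prod {ι : Type*} {σ : ℝ} (hσ : 0 < σ) (hσ1 : σ ≤ 1)
    (T : Finset ι) (X : ι → ℝ) (h0 : ∀ i ∈ T, 0 ≤ X i) (h1 : ∀ i ∈ T, X i ≤ σ) {s : ℝ}
    (hs : 0 ≤ s) :
    ∫ t in (0 : ℝ)..1, Real.exp (-(t * (s + ∑ i ∈ T, X i))) ≤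
      ∫ t in (0 : ℝ)..1, (∏ i ∈ T, (1 - t * g (X i) σ)) * Real.exp (-(t * s)) := by
  classical
  induction T using Finset.induction_on generalizing s with
  | empty => simp
  | insert a T ha ih =>
    have hT0 : ∀ i ∈ T, 0 ≤ X i := fun i hi => h0 i (Finset.mem_insert_of_mem hi)
    have hT1 : ∀ i ∈ T, X i ≤ σ := fun i hi => h1 i (Finset.mem_insert_of_mem hi)
    have ha0 := h0 a (Finset.mem_insert_self _ _)
    have ha1 := h1 a (Finset.mem_insert_self _ _)
    have hIH := ih hT0 hT1 (add_nonneg hs ha0)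
    rw [Finset.sum_insert ha, ← add_assoc]
    refine hIH.trans ?_
    have hfac : ∀ i ∈ T, ∀ t ∈ Set.Icc (0 : ℝ) 1, 0 ≤ 1 - t * g (X i) σ := by
      intro i hi t ht
      have := g_nonneg (hT0 i hi) (hT1 i hi)
      have := g_le_self (hT0 i hi) (hT1 i hi) hσ
      nlinarith [ht.1, ht.2, hT1 i hi]
    have key := integral_mul_nonneg_of_concaveOn
      (P := fun t => (∏ i ∈ T, (1 - t * g (X i) σ)) * Real.exp (-(t * s)))
      (f := fun t => 1 - t * g (X a) σ - Real.exp (-(t * X a)))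
      (by
        intro t ht u hu htu
        dsimp only
        refine mul_le_mul (Finset.prod_le_prod (fun i hi => hfac i hi u hu) fun i hi => ?_) ?_
          (Real.exp_pos _).le (Finset.prod_nonneg fun i hi => hfac i hi t ht)
        · have := g_nonneg (hT0 i hi) (hT1 i hi)
          gcongr
        · gcongr)
      (fun t ht => mul_nonneg (Finset.prod_nonneg fun i hi => hfac i hi t ht)
        (Real.exp_pos _).le)
      (by fun_prop) (concaveOn_linear_sub_exp _ _) (by simp) (by fun_prop)
      (integral_linear_sub_exp_nonneg ha0 ha1 hσ hσ1)
    rw [← sub_nonneg, ← intervalIntegral.integral_sub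
      (Continuous.intervalIntegrable (by fun_prop) _ _)
      (Continuous.intervalIntegrable (by fun_prop) _ _)]
    refine key.trans_eq (intervalIntegral.integral_congr fun t _ => ?_)
    have e : Real.exp (-(t * (s + X a))) = Real.exp (-(t * s)) * Real.exp (-(t * X a)) := by
      rw [← Real.exp_add]; ring_nf
    simp only [Finset.prod_insert ha, e]
    ring

/-- This equation dictates the formula for `g`. At `x = σ` the integral is `1`, which explains the
value `1 - exp (-σ)` there. -/
lemma g_mul_integral_exp {x σ : ℝ} (hσ : 0 < σ) (h : x ≤ σ) :
    g x σ * ∫ t in (0 : ℝ)..1, Real.exp (-(t * (σ - x))) = (1 - Real.exp (-σ)) / σ * x := by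
  rcases h.eq_or_lt with rfl | h
  · simp [g_self, hσ.ne']
  · have h1 : Real.exp x < Real.exp σ := Real.exp_lt_exp.2 h
    have h2 : Real.exp σ - Real.exp x ≠ 0 := by linarith
    have h3 : σ - x ≠ 0 := by linarith
    have h4 := Real.exp_ne_zero σ
    rw [integral_exp_neg_mul h3, g_of_lt h, neg_sub, Real.exp_sub, Real.exp_neg]
    field_simp

/-- The coefficients `1 / (|S| + 1)` are also the probabilities that a vertex comes after all of `S`
in a random order; this links permutations to arrival times. -/
lemma integral_prod_one_sub {ι : Type*} (T : Finset ι) (q : ι → ℝ) :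
    ∫ t in (0 : ℝ)..1, ∏ i ∈ T, (1 - t * q i) =
      ∑ S ∈ T.powerset, (∏ i ∈ S, -q i) / (S.card + 1) := by
  classical
  have h : ∀ t : ℝ, ∏ i ∈ T, (1 - t * q i) =
      ∑ S ∈ T.powerset, t ^ S.card * ∏ i ∈ S, -q i := by
    intro t
    simp_rw [sub_eq_add_neg, Finset.prod_one_add, ← mul_neg, Finset.prod_mul_distrib,
      Finset.prod_const]
  simp_rw [h]
  rw [intervalIntegral.integral_finsetSum fun S _ =>
    Continuous.intervalIntegrable (by fun_prop) _ _]
  refine Finset.sum_congr rfl fun S _ => ?_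
  rw [intervalIntegral.integral_mul_const, integral_pow]
  simp
  ring

/-- The probability that an edge of fractional value `X v` is the first one proposed to a vertex,
when the fractional values at this vertex add up to `σ`. -/
lemma le_g_mul_sum_powerset {ι : Type*} [Fintype ι] [DecidableEq ι] {σ : ℝ} (hσ : 0 < σ)
    (hσ1 : σ ≤ 1) (X : ι → ℝ) (h0 : ∀ i, 0 ≤ X i) (hX : ∑ i, X i = σ) (v : ι) :
    (1 - Real.exp (-σ)) / σ * X v ≤ g (X v) σ *
      ∑ S ∈ (Finset.univ.erase v).powerset, (∏ i ∈ S, -g (X i) σ) / (S.card + 1) := by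
  have h1 : ∀ i, X i ≤ σ := fun i =>
    hX ▸ Finset.single_le_sum (fun j _ => h0 j) (Finset.mem_univ i)
  rw [← integral_prod_one_sub, ← g_mul_integral_exp hσ (h1 v)]
  refine mul_le_mul_of_nonneg_left ?_ (g_nonneg (h0 v) (h1 v))
  have h := integral_exp_le_integral_prod hσ hσ1 (Finset.univ.erase v) X (fun i _ => h0 i)
    (fun i _ => h1 i) le_rfl
  have e : ∑ i ∈ Finset.univ.erase v, X i = σ - X v := by
    rw [← hX, ← Finset.add_sum_erase _ _ (Finset.mem_univ v)]; ring
  simpa [e] using h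

open scoped ENNReal

/-! ### Laws of the random choices -/

lemma coin_true {q : ℝ} (h1 : q ≤ 1) : coin q true = ENNReal.ofReal q := by
  simp [coin, h1]

lemma coin_false {q : ℝ} (h0 : 0 ≤ q) (h1 : q ≤ 1) : coin q false = ENNReal.ofReal (1 - q) := by
  simp [coin, h1, ENNReal.ofReal_sub _ h0]

lemma uniform01_Ioc {a b : ℝ} (ha : 0 ≤ a) (hb : b ≤ 1) :
    uniform01 (Set.Ioc a b) = ENNReal.ofReal (b - a) := by
  rw [uniform01, Measure.restrict_apply measurableSet_Ioc, Set.inter_eq_left.2, Real.volume_Ioc]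
  exact fun t ht => ⟨ha.trans ht.1.le, ht.2.trans hb⟩

lemma uniform01_Ioi {a : ℝ} (ha : 0 ≤ a) : uniform01 (Set.Ioi a) = ENNReal.ofReal (1 - a) := by
  rw [uniform01, Measure.restrict_apply measurableSet_Ioi, ← Real.volume_Ioc]
  congr 1
  ext t
  simp only [Set.mem_inter_iff, Set.mem_Ioi, Set.mem_Icc, Set.mem_Ioc]
  exact ⟨fun h => ⟨h.1, h.2.2⟩, fun h => ⟨h.1, ha.trans h.1.le, h.2⟩⟩

lemma drawAct_apply (q r : ℝ) (a : Act) :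
    drawAct q r a = uniform01 (actOf q r ⁻¹' {a}) := by
  rw [drawAct, Measure.toPMF_apply, Measure.map_apply (measurable_actOf q r)
    (measurableSet_singleton a)]

lemma drawAct_keep {q r : ℝ} (hq0 : 0 ≤ q) (hq1 : q ≤ 1) (hr1 : r ≤ 1) :
    drawAct q r .keep = ENNReal.ofReal r := by
  have : actOf q r ⁻¹' {.keep} = Set.Ioc (q * (1 - r)) (q * (1 - r) + r) := by
    ext c
    simp only [actOf, Set.mem_preimage, Set.mem_singleton_iff, Set.mem_Ioc]
    split_ifs <;> grind
  rw [drawAct_apply, this, uniform01_Ioc (mul_nonneg hq0 (by linarith)) (by nlinarith)]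
  ring_nf

lemma drawAct_skip {q r : ℝ} (hq0 : 0 ≤ q) (hr0 : 0 ≤ r) (hr1 : r ≤ 1) :
    drawAct q r .skip = ENNReal.ofReal ((1 - q) * (1 - r)) := by
  have : actOf q r ⁻¹' {.skip} = Set.Ioi (q * (1 - r) + r) := by
    ext c
    simp only [actOf, Set.mem_preimage, Set.mem_singleton_iff, Set.mem_Ioi]
    split_ifs <;> grind
  rw [drawAct_apply, this, uniform01_Ioi
    (add_nonneg (mul_nonneg hq0 (by linarith)) hr0)]
  ring_nf

instance : Fintype Act := ⟨{.halt, .keep, .skip}, fun a => by cases a <;> simp⟩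

lemma tsum_act (f : Act → ℝ≥0∞) : ∑' a, f a = f .halt + (f .keep + f .skip) := by
  rw [tsum_fintype]
  change ∑ a ∈ ({.halt, .keep, .skip} : Finset Act), f a = _
  rw [Finset.sum_insert (by simp), Finset.sum_insert (by simp), Finset.sum_singleton]

section Vertex

variable {B : Type*}

lemma firstRealized_cons_apply [DecidableEq B] {q : B → ℝ} {u : B} (h0 : 0 ≤ q u) (h1 : q u ≤ 1)
    (l : List B) (w : B) :
    firstRealized q (u :: l) (some w) =
      ENNReal.ofReal (q u) * (if w = u then 1 else 0) +
        ENNReal.ofReal (1 - q u) * firstRealized q l (some w) := by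
  rw [firstRealized, PMF.bind_apply, tsum_bool, coin_true h1, coin_false h0 h1]
  simp [PMF.pure_apply, add_comm]

/-- At an edge with probability `q` and ratio `r`, selection has probability `r * q`, and moving on
has probability `r * (1 - q) + (1 - q) * (1 - r) = 1 - q`. Later edges are therefore reached as
often as without thinning. -/
lemma thin_bind_firstRealized [DecidableEq B] (q r : B → ℝ) (l : List B)
    (hq0 : ∀ u ∈ l, 0 ≤ q u) (hq1 : ∀ u ∈ l, q u ≤ 1) (hr0 : ∀ u ∈ l, 0 ≤ r u)
    (hr1 : ∀ u ∈ l, r u ≤ 1) (w : B) :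
    ((thin q r l).bind (firstRealized q)) (some w) =
      firstRealized q l (some w) * ENNReal.ofReal (r w) := by
  induction l with
  | nil => simp [thin, firstRealized]
  | cons u l ih =>
    simp only [List.forall_mem_cons] at hq0 hq1 hr0 hr1
    have hI := ih hq0.2 hq1.2 hr0.2 hr1.2
    have hkeep : (((thin q r l).map (u :: ·)).bind (firstRealized q)) (some w) =
        ENNReal.ofReal (q u) * (if w = u then 1 else 0) +
          ENNReal.ofReal (1 - q u) * (firstRealized q l (some w) * ENNReal.ofReal (r w)) := by
      rw [PMF.bind_map, PMF.bind_apply]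
      simp only [Function.comp_apply, firstRealized_cons_apply hq0.1 hq1.1, mul_add,
        ENNReal.tsum_add, ENNReal.tsum_mul_right, PMF.tsum_coe, one_mul]
      rw [← hI, PMF.bind_apply, ← ENNReal.tsum_mul_left]
      congr 1
      exact tsum_congr fun _ => mul_left_comm _ _ _
    rw [thin, PMF.bind_bind, PMF.bind_apply, tsum_act, firstRealized_cons_apply hq0.1 hq1.1]
    simp only [hkeep, hI, drawAct_keep hq0.1 hq1.1 hr1.1, drawAct_skip hq0.1 hr0.1 hr1.1]
    have h1 : ((PMF.pure ([] : List B)).bind (firstRealized q)) (some w) = 0 := by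
      simp [firstRealized]
    rw [h1, mul_zero, zero_add, mul_add, add_assoc, ← mul_assoc (ENNReal.ofReal (r u))
      (ENNReal.ofReal (1 - q u)), ← add_mul, ← ENNReal.ofReal_mul hr0.1,
      ← ENNReal.ofReal_add (mul_nonneg hr0.1 (sub_nonneg.2 hq1.1))
        (mul_nonneg (sub_nonneg.2 hq1.1) (sub_nonneg.2 hr1.1)), add_mul]
    have h2 : r u * (1 - q u) + (1 - q u) * (1 - r u) = 1 - q u := by ring
    rw [h2]
    split_ifs with h
    · subst h; ring
    · simp [mul_assoc]

lemma mem_of_some_mem_support_firstRealized (q : B → ℝ) (l : List B) {w : B}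
    (h : some w ∈ (firstRealized q l).support) : w ∈ l := by
  induction l with
  | nil => simp [firstRealized] at h
  | cons u l ih =>
    rw [firstRealized, PMF.mem_support_bind_iff] at h
    obtain ⟨b, -, hb⟩ := h
    cases b
    · exact List.mem_cons_of_mem _ (ih (by simpa using hb))
    · simp at hb; simp [hb]

lemma subset_of_mem_support_thin (q r : B → ℝ) (l : List B) {l' : List B}
    (h : l' ∈ (thin q r l).support) : l' ⊆ l := by
  induction l generalizing l' with
  | nil => simp [thin] at h; simp [h]
  | cons u l ih =>
    rw [thin, PMF.mem_support_bind_iff] at h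
    obtain ⟨a, -, ha⟩ := h
    cases a
    · simp at ha; simp [ha]
    · simp only [PMF.mem_support_map_iff] at ha
      obtain ⟨l'', hl'', rfl⟩ := ha
      exact List.cons_subset_cons _ (ih hl'')
    · exact List.subset_cons_of_subset _ (ih ha)

end Vertex

section Proposal

variable {V B : Type*}

lemma mem_edges_of_some_mem_support_proposal {E : Finset (V × B)} {p x xt : V × B → ℝ}
    {D : PMF (List B)} {v : V} (hD : IsProportional E p x v D) {u : B}
    (h : some u ∈ (proposal p x xt D v).support) : (v, u) ∈ E := by
  rw [proposal, PMF.mem_support_bind_iff] at h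
  obtain ⟨l', hl', hu⟩ := h
  rw [PMF.mem_support_bind_iff] at hl'
  obtain ⟨l, hl, hl'⟩ := hl'
  exact (hD.1 l hl).2 u (subset_of_mem_support_thin _ _ _ hl'
    (mem_of_some_mem_support_firstRealized _ _ hu))

lemma proposal_apply_of_notMem {E : Finset (V × B)} {p x xt : V × B → ℝ}
    {D : PMF (List B)} {v : V} (hD : IsProportional E p x v D) {u : B} (h : (v, u) ∉ E) :
    proposal p x xt D v (some u) = 0 := by
  by_contra hne
  exact h (mem_edges_of_some_mem_support_proposal hD ((PMF.mem_support_iff _ _).2 hne))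

lemma proposal_apply [DecidableEq B] {E : Finset (V × B)} {p x xt : V × B → ℝ} {D : PMF (List B)} {v : V}
    (hp0 : ∀ e ∈ E, 0 ≤ p e) (hp1 : ∀ e ∈ E, p e ≤ 1) (hxt0 : ∀ e ∈ E, 0 ≤ xt e)
    (hxt1 : ∀ e ∈ E, xt e ≤ x e) (hD : IsProportional E p x v D) {u : B} (h : (v, u) ∈ E) :
    proposal p x xt D v (some u) = ENNReal.ofReal (xt (v, u)) := by
  have hx0 : ∀ e ∈ E, 0 ≤ x e := fun e he => (hxt0 e he).trans (hxt1 e he)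
  have hl : ∀ l, D l * ((thin (fun u => p (v, u)) (fun u => xt (v, u) / x (v, u)) l).bind
      (firstRealized fun u => p (v, u))) (some u) = D l *
        (firstRealized (fun u => p (v, u)) l (some u)) *
          ENNReal.ofReal (xt (v, u) / x (v, u)) := by
    intro l
    by_cases hl : D l = 0
    · simp [hl]
    have hE := (hD.1 l ((PMF.mem_support_iff _ _).2 hl)).2
    rw [thin_bind_firstRealized _ _ _ (fun u hu => hp0 _ (hE u hu))
      (fun u hu => hp1 _ (hE u hu))
      (fun u hu => div_nonneg (hxt0 _ (hE u hu)) (hx0 _ (hE u hu)))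
      (fun u hu => div_le_one_of_le₀ (hxt1 _ (hE u hu)) (hx0 _ (hE u hu))), mul_assoc]
  rw [proposal, PMF.bind_bind, PMF.bind_apply, tsum_congr hl, ENNReal.tsum_mul_right,
    ← PMF.bind_apply, hD.2 u h, ← ENNReal.ofReal_mul (hx0 _ h)]
  -- For `x = 0` the ratio takes the default value `0`; this is harmless, since `xt ≤ x` then forces
  -- `xt = 0`.
  rcases (hx0 _ h).eq_or_lt with h0 | h0
  · have h1 := hxt0 _ h
    have h2 := hxt1 _ h
    rw [← h0] at h2 ⊢
    simp [le_antisymm h2 h1]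
  · rw [mul_div_cancel₀ _ h0.ne']

end Proposal

/-! ### Running the algorithm -/

lemma expect_bind {α β : Type*} [Fintype α] [Fintype β] (P : PMF α) (f : α → PMF β) (h : β → ℝ) :
    expect (P.bind f) h = expect P fun a => expect (f a) h := by
  have h1 : ∀ b, ((P.bind f) b).toReal = ∑ a, (P a).toReal * (f a b).toReal := by
    intro b
    rw [PMF.bind_apply, tsum_fintype, ENNReal.toReal_sum fun a _ =>
      ENNReal.mul_ne_top (PMF.apply_ne_top _ _) (PMF.apply_ne_top _ _)]
    simp
  simp only [expect, h1, Finset.sum_mul, Finset.mul_sum]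
  rw [Finset.sum_comm]
  simp only [mul_assoc]

lemma expect_pure {α : Type*} [Fintype α] (a : α) (h : α → ℝ) : expect (PMF.pure a) h = h a := by
  classical
  simp [expect, PMF.pure_apply, apply_ite ENNReal.toReal]

lemma sum_toReal {α : Type*} [Fintype α] (P : PMF α) : ∑ a, (P a).toReal = 1 := by
  rw [← ENNReal.toReal_sum fun a _ => PMF.apply_ne_top _ _, ← tsum_fintype (L := .unconditional _),
    P.tsum_coe, ENNReal.toReal_one]

lemma expect_const {α : Type*} [Fintype α] (P : PMF α) (c : ℝ) : expect P (fun _ => c) = c := by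
  simp [expect, ← Finset.sum_mul, sum_toReal]

section Run

variable {V B : Type*} [DecidableEq V] [DecidableEq B]

lemma mem_respond_of_mem {M : Finset (V × B)} {e : V × B} (he : e ∈ M) (v : V) (o : Option B) :
    e ∈ respond M v o := by
  cases o with
  | none => exact he
  | some u =>
    simp only [respond]
    split_ifs
    · exact Finset.mem_insert_of_mem he
    · exact he

lemma mem_respond {M : Finset (V × B)} {e : V × B} {v : V} {o : Option B}
    (he : e ∈ respond M v o) :
    e ∈ M ∨ e.1 = v ∧ o = some e.2 ∧ ∀ f ∈ M, f.2 ≠ e.2 := by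
  cases o with
  | none => exact Or.inl he
  | some u =>
    simp only [respond] at he
    split_ifs at he with h
    · rcases Finset.mem_insert.1 he with rfl | he
      · exact Or.inr ⟨rfl, rfl, h⟩
      · exact Or.inl he
    · exact Or.inl he

/-- `hML` is the invariant that matched left vertices are no longer in the list; right end-points
stay distinct because only unmatched vertices accept. -/
lemma runList_support {E : Finset (V × B)} {prop : V → PMF (Option B)}
    (hprop : ∀ v u, some u ∈ (prop v).support → (v, u) ∈ E) (L : List V) (hL : L.Nodup)
    (M : Finset (V × B)) (hM : IsMatching M) (hME : M ⊆ E) (hML : ∀ e ∈ M, e.1 ∉ L)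
    {M' : Finset (V × B)} (h : M' ∈ (runList prop L M).support) : IsMatching M' ∧ M' ⊆ E := by
  induction L generalizing M with
  | nil => simp [runList] at h; exact h ▸ ⟨hM, hME⟩
  | cons v L ih =>
    rw [runList, PMF.mem_support_bind_iff] at h
    obtain ⟨o, ho, h⟩ := h
    rw [List.nodup_cons] at hL
    refine ih hL.2 (respond M v o) ?_ ?_ ?_ h
    · intro e he f hf hef
      rcases mem_respond he with he | ⟨he1, he2, he3⟩ <;>
        rcases mem_respond hf with hf | ⟨hf1, hf2, hf3⟩
      · exact hM e he f hf hef
      · exact ⟨fun h => hML e he (by simp [h, hf1]), hf3 e he⟩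
      · exact ⟨fun h => hML f hf (by simp [← h, he1]), (he3 f hf).symm⟩
      · exact absurd (Prod.ext (he1.trans hf1.symm)
          (Option.some_injective _ (he2.symm.trans hf2))) hef
    · intro e he
      rcases mem_respond he with he | ⟨rfl, rfl, -⟩
      · exact hME he
      · exact hprop _ _ ho
    · intro e he
      rcases mem_respond he with he | ⟨rfl, -, -⟩
      · exact fun h => hML e he (List.mem_cons_of_mem _ h)
      · exact hL.1

lemma runRandom_support [Fintype V] {E : Finset (V × B)} {prop : V → PMF (Option B)}
    (hprop : ∀ v u, some u ∈ (prop v).support → (v, u) ∈ E) {M : Finset (V × B)}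
    (h : M ∈ (runRandom prop).support) : IsMatching M ∧ M ⊆ E := by
  rw [runRandom, PMF.mem_support_bind_iff] at h
  obtain ⟨π, -, h⟩ := h
  exact runList_support hprop _ ((Finset.nodup_toList _).map π.injective) ∅
    (fun e he => absurd he (Finset.notMem_empty e)) (Finset.empty_subset _)
    (fun e he => absurd he (Finset.notMem_empty e)) h

variable [Fintype V] [Fintype B]

lemma expect_runList_of_mem (prop : V → PMF (Option B)) (L : List V) (M : Finset (V × B))
    {e : V × B} (h : e ∈ M) : expect (runList prop L M) (fun M' => if e ∈ M' then 1 else 0) = 1 := by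
  induction L generalizing M with
  | nil => simp [runList, expect_pure, h]
  | cons v L ih =>
    rw [runList, expect_bind]
    simp only [ih _ (mem_respond_of_mem h v _), expect_const]

lemma expect_runList_of_notMem (prop : V → PMF (Option B)) (L : List V) (M : Finset (V × B))
    {e : V × B} (h : e ∉ M) (hL : e.1 ∉ L ∨ ∃ f ∈ M, f.2 = e.2) :
    expect (runList prop L M) (fun M' => if e ∈ M' then 1 else 0) = 0 := by
  induction L generalizing M with
  | nil => simp [runList, expect_pure, h]
  | cons v L ih =>
    have h1 : ∀ o, e ∉ respond M v o := by
      intro o he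
      rcases mem_respond he with he | ⟨rfl, -, h2⟩
      · exact h he
      · rcases hL with hL | ⟨f, hf, hfe⟩
        · exact hL (List.mem_cons_self)
        · exact h2 f hf hfe
    have h2 : ∀ o, e.1 ∉ L ∨ ∃ f ∈ respond M v o, f.2 = e.2 := fun o =>
      hL.imp (fun h hL => h (List.mem_cons_of_mem _ hL))
        (fun ⟨f, hf, hfe⟩ => ⟨f, mem_respond_of_mem hf v o, hfe⟩)
    rw [runList, expect_bind]
    simp only [ih _ (h1 _) (h2 _), expect_const]

/-- Since `u` accepts its first proposal, only the independent events "`v'` proposes to `u`", for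
`v'` up to `v`, matter. The rest of the current matching is irrelevant as long as `u` is free. -/
lemma expect_runList (prop : V → PMF (Option B)) (L : List V) (hL : L.Nodup) {v : V} (hv : v ∈ L)
    (u : B) (M : Finset (V × B)) (hM : ∀ e ∈ M, e.2 ≠ u) :
    expect (runList prop L M) (fun M' => if (v, u) ∈ M' then 1 else 0) =
      (prop v (some u)).toReal *
        ((L.takeWhile (· ≠ v)).map fun v' => 1 - (prop v' (some u)).toReal).prod := by
  induction L generalizing M with
  | nil => simp at hv
  | cons a L ih =>
    have hvu : (v, u) ∉ M := fun h => hM _ h rfl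
    have hresp : respond M a (some u) = insert (a, u) M := by simp only [respond, if_pos hM]
    rw [List.nodup_cons] at hL
    rw [runList, expect_bind, expect]
    by_cases hav : a = v
    · subst hav
      have h0 : ∀ o ∈ Finset.univ, o ≠ some u → (prop a o).toReal *
          expect (runList prop L (respond M a o)) (fun M' => if (a, u) ∈ M' then 1 else 0) = 0 := by
        intro o _ ho
        rw [expect_runList_of_notMem prop L _ ?_ (Or.inl hL.1), mul_zero]
        intro h
        rcases mem_respond h with h | ⟨-, h, -⟩
        · exact hvu h
        · exact ho h
      rw [Finset.sum_eq_single (some u) h0 (by simp), hresp,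
        expect_runList_of_mem prop L _ (Finset.mem_insert_self _ _)]
      simp
    · have hvL : v ∈ L := (List.mem_cons.1 hv).resolve_left (Ne.symm hav)
      have h1 : ∀ o ≠ some u, ∀ e ∈ respond M a o, e.2 ≠ u := by
        intro o ho e he h
        rcases mem_respond he with he | ⟨-, he, -⟩
        · exact hM e he h
        · exact ho (h ▸ he)
      have h2 : expect (runList prop L (respond M a (some u)))
          (fun M' => if (v, u) ∈ M' then 1 else 0) = 0 := by
        rw [hresp]
        refine expect_runList_of_notMem prop L _ ?_
          (Or.inr ⟨(a, u), Finset.mem_insert_self _ _, rfl⟩)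
        simp [hvu, Ne.symm hav]
      rw [← Finset.add_sum_erase _ _ (Finset.mem_univ (some u)), h2, mul_zero, zero_add,
        Finset.sum_congr rfl fun o ho => by
          rw [ih hL.2 hvL (respond M a o) (h1 o (Finset.ne_of_mem_erase ho))],
        ← Finset.sum_mul]
      have h3 := sum_toReal (prop a)
      rw [← Finset.add_sum_erase _ _ (Finset.mem_univ (some u))] at h3
      rw [show ∑ o ∈ Finset.univ.erase (some u), (prop a o).toReal =
        1 - (prop a (some u)).toReal by linarith]
      simp [hav]
      ring

end Run

/-! ### Random orders -/

lemma mem_takeWhile_ne_iff {α : Type*} [DecidableEq α] (l : List α) (v w : α) (hw : w ∈ l) :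
    w ∈ l.takeWhile (· ≠ v) ↔ l.idxOf w < l.idxOf v := by
  induction l with
  | nil => simp at hw
  | cons a l ih =>
    by_cases hav : a = v
    · simp [hav]
    · by_cases haw : a = w
      · subst haw
        rw [List.idxOf_cons_self, List.idxOf_cons_ne _ hav]
        simp [hav]
      · have hwl : w ∈ l := (List.mem_cons.1 hw).resolve_left (Ne.symm haw)
        simp only [List.takeWhile_cons, ne_eq, hav, not_false_eq_true, decide_true, if_true,
          List.mem_cons, Ne.symm haw, false_or]
        rw [List.idxOf_cons_ne _ haw, List.idxOf_cons_ne _ hav, Nat.succ_lt_succ_iff]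
        exact ih hwl

lemma idxOf_map_equiv {α : Type*} [DecidableEq α] (f : Equiv.Perm α) (l : List α) (a : α) :
    (l.map f).idxOf (f a) = l.idxOf a := by
  induction l with
  | nil => simp
  | cons b l ih =>
    by_cases h : b = a
    · subst h; simp
    · rw [List.map_cons, List.idxOf_cons_ne _ (f.injective.ne h), List.idxOf_cons_ne _ h, ih]

section Order

variable {V : Type*} [Fintype V]

/-- The order in which the vertices are processed. -/
def order (π : Equiv.Perm V) : List V := (Finset.univ : Finset V).toList.map π

lemma mem_order (π : Equiv.Perm V) (v : V) : v ∈ order π :=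
  List.mem_map.2 ⟨π.symm v, by simp, by simp⟩

lemma nodup_order (π : Equiv.Perm V) : (order π).Nodup :=
  (Finset.nodup_toList _).map π.injective

variable [DecidableEq V]

/-- `v` comes after all other elements of `T`. -/
def IsLastOf (T : Finset V) (v : V) (π : Equiv.Perm V) : Prop :=
  ∀ s ∈ T, s ≠ v → (order π).idxOf s < (order π).idxOf v

instance (T : Finset V) (v : V) : DecidablePred (IsLastOf T v) := fun _ => by
  unfold IsLastOf; infer_instance

lemma existsUnique_isLastOf (T : Finset V) (hT : T.Nonempty) (π : Equiv.Perm V) :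
    ∃! v, v ∈ T ∧ IsLastOf T v π := by
  obtain ⟨v, hv, hmax⟩ := T.exists_max_image (fun s => (order π).idxOf s) hT
  refine ⟨v, ⟨hv, fun s hs hsv => lt_of_le_of_ne (hmax s hs) fun h => hsv ?_⟩, ?_⟩
  · exact (List.idxOf_inj (mem_order π s)).1 h
  · rintro w ⟨hw, hlast⟩
    by_contra hne
    exact absurd (hlast v hv (Ne.symm hne)) (not_lt.2 (hmax w hw))

/-- Exchanging `v` and `w` in the order is the symmetry that makes all elements of `T` equally
likely to be last. -/
lemma isLastOf_swap_mul {T : Finset V} {v w : V} (hv : v ∈ T) (hw : w ∈ T) {π : Equiv.Perm V}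
    (h : IsLastOf T w π) : IsLastOf T v (Equiv.swap v w * π) := by
  have hord : order (Equiv.swap v w * π) = (order π).map (Equiv.swap v w) := by
    simp [order, List.map_map, Function.comp_def]
  have hidx : ∀ s, (order (Equiv.swap v w * π)).idxOf s =
      (order π).idxOf (Equiv.swap v w s) := by
    intro s
    rw [hord, ← idxOf_map_equiv (Equiv.swap v w) (order π), Equiv.swap_apply_self]
  intro s hs hsv
  rw [hidx, hidx, Equiv.swap_apply_left]
  refine h _ ?_ ?_
  · rcases eq_or_ne s w with rfl | hsw
    · rwa [Equiv.swap_apply_right]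
    · rwa [Equiv.swap_apply_of_ne_of_ne hsv hsw]
  · intro h'
    exact hsv (by rw [← Equiv.swap_apply_self v w s, h', Equiv.swap_apply_right])

/-- Every element of `T` is the last one of `T` in a random order with probability `1 / |T|`. -/
lemma card_mul_card_isLastOf {T : Finset V} {v : V} (hv : v ∈ T) :
    T.card * (Finset.univ.filter (IsLastOf T v)).card = Fintype.card (Equiv.Perm V) := by
  have h1 : ∀ w ∈ T, (Finset.univ.filter (IsLastOf T w)).card =
      (Finset.univ.filter (IsLastOf T v)).card := by
    intro w hw
    refine Finset.card_bij' (fun π _ => Equiv.swap v w * π) (fun π _ => Equiv.swap v w * π)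
      ?_ ?_ ?_ ?_
    · intro π hπ
      simpa using isLastOf_swap_mul hv hw (by simpa using hπ)
    · intro π hπ
      rw [Equiv.swap_comm]
      simpa using isLastOf_swap_mul hw hv (by simpa using hπ)
    · intro π _; simp [← mul_assoc]
    · intro π _; simp [← mul_assoc]
  have h2 : ∑ w ∈ T, (Finset.univ.filter (IsLastOf T w)).card =
      Fintype.card (Equiv.Perm V) := by
    simp_rw [Finset.card_filter]
    rw [Finset.sum_comm, ← Finset.card_univ, Finset.card_eq_sum_ones]
    refine Finset.sum_congr rfl fun π _ => ?_
    obtain ⟨w, ⟨hw, hlast⟩, huniq⟩ := existsUnique_isLastOf T ⟨v, hv⟩ π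
    rw [Finset.sum_eq_single w, if_pos hlast]
    · intro w' hw' hne
      exact if_neg fun h => hne (huniq w' ⟨hw', h⟩)
    · exact fun h => absurd hw h
  rw [← h2, Finset.sum_congr rfl h1, Finset.sum_const, smul_eq_mul]

/-- Expand the product over the predecessors of `v` into subsets: `S` consists of predecessors iff
`v` is last in `insert v S`, an event whose probability is known. -/
lemma prod_map_takeWhile_order (q : V → ℝ) (v : V) (π : Equiv.Perm V) :
    (((order π).takeWhile (· ≠ v)).map fun w => 1 - q w).prod =
      ∑ S ∈ (Finset.univ.erase v).powerset,
        if IsLastOf (insert v S) v π then ∏ w ∈ S, -q w else 0 := by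
  have hnd : ((order π).takeWhile (· ≠ v)).Nodup :=
    (List.takeWhile_sublist _).nodup (nodup_order π)
  rw [← List.prod_toFinset _ hnd]
  simp_rw [sub_eq_add_neg]
  rw [Finset.prod_one_add, ← Finset.sum_filter]
  refine Finset.sum_congr ?_ fun _ _ => rfl
  ext S
  simp only [Finset.mem_powerset, Finset.mem_filter, Finset.subset_iff, List.mem_toFinset,
    Finset.mem_erase, Finset.mem_univ, and_true, IsLastOf, Finset.mem_insert]
  constructor
  · intro h
    refine ⟨fun w hw hwv => ?_, fun s hs hsv =>
      (mem_takeWhile_ne_iff _ _ _ (mem_order π s)).1 (h (hs.resolve_left hsv))⟩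
    have h1 := (mem_takeWhile_ne_iff _ _ _ (mem_order π w)).1 (h hw)
    rw [hwv] at h1
    exact lt_irrefl _ h1
  · rintro ⟨h1, h2⟩ s hs
    exact (mem_takeWhile_ne_iff _ _ _ (mem_order π s)).2 (h2 s (Or.inr hs) (h1 hs))

lemma expect_uniform_prod_takeWhile (q : V → ℝ) (v : V) :
    expect (PMF.uniformOfFintype (Equiv.Perm V))
      (fun π => (((order π).takeWhile (· ≠ v)).map fun w => 1 - q w).prod) =
      ∑ S ∈ (Finset.univ.erase v).powerset, (∏ w ∈ S, -q w) / (S.card + 1) := by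
  simp only [expect, PMF.uniformOfFintype_apply, ENNReal.toReal_inv, ENNReal.toReal_natCast,
    prod_map_takeWhile_order]
  rw [← Finset.mul_sum, Finset.sum_comm, Finset.mul_sum]
  refine Finset.sum_congr rfl fun S hS => ?_
  have hvS : v ∉ S := fun h => by simpa using Finset.mem_powerset.1 hS h
  have h := card_mul_card_isLastOf (Finset.mem_insert_self v S)
  rw [Finset.card_insert_of_notMem hvS] at h
  have h' : ((S.card : ℝ) + 1) *
      ((Finset.univ.filter (IsLastOf (insert v S) v)).card : ℝ) =
      (Fintype.card (Equiv.Perm V) : ℝ) := by exact_mod_cast h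
  have hpos : (Fintype.card (Equiv.Perm V) : ℝ) ≠ 0 := by
    exact_mod_cast Fintype.card_ne_zero
  rw [← Finset.sum_filter, Finset.sum_const, nsmul_eq_mul]
  have h1 : (S.card : ℝ) + 1 ≠ 0 := by positivity
  rw [eq_div_iff h1]
  rw [← h'] at hpos ⊢
  have h2 := right_ne_zero_of_mul hpos
  field_simp

lemma expect_runRandom {B : Type*} [DecidableEq B] [Fintype B] (prop : V → PMF (Option B)) (v : V)
    (u : B) :
    expect (runRandom prop) (fun M => if (v, u) ∈ M then 1 else 0) =
      (prop v (some u)).toReal * ∑ S ∈ (Finset.univ.erase v).powerset,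
        (∏ w ∈ S, -(prop w (some u)).toReal) / (S.card + 1) := by
  rw [← expect_uniform_prod_takeWhile, runRandom, expect_bind, expect, expect, Finset.mul_sum]
  refine Finset.sum_congr rfl fun π _ => ?_
  have h := expect_runList prop (order π) (nodup_order π) (mem_order π v) u ∅ (by simp)
  rw [order] at h
  rw [h, order]
  ring

end Order

/-! ### Existence of proportional distributions -/

section Greedy

variable {B : Type*}

lemma firstRealized_apply_of_notMem (q : B → ℝ) {l : List B} {w : B} (h : w ∉ l) :
    firstRealized q l (some w) = 0 := by
  by_contra hne
  exact h (mem_of_some_mem_support_firstRealized q l ((PMF.mem_support_iff _ _).2 hne))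

lemma firstRealized_apply_none (q : B → ℝ) (l : List B) (h0 : ∀ u ∈ l, 0 ≤ q u)
    (h1 : ∀ u ∈ l, q u ≤ 1) :
    firstRealized q l none = ENNReal.ofReal ((l.map fun u => 1 - q u).prod) := by
  induction l with
  | nil => simp [firstRealized]
  | cons u l ih =>
    simp only [List.forall_mem_cons] at h0 h1
    rw [firstRealized, PMF.bind_apply, tsum_bool, coin_true h1.1, coin_false h0.1 h1.1,
      List.map_cons, List.prod_cons, ENNReal.ofReal_mul (by linarith [h1.1]), ← ih h0.2 h1.2]
    simp [PMF.pure_apply]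

variable [DecidableEq B]

lemma firstRealized_append_of_ne (q : B → ℝ) (l : List B) (h0 : ∀ u ∈ l, 0 ≤ q u)
    (h1 : ∀ u ∈ l, q u ≤ 1) {v w : B} (hw : w ≠ v) :
    firstRealized q (l ++ [v]) (some w) = firstRealized q l (some w) := by
  induction l with
  | nil => rw [List.nil_append, firstRealized_apply_of_notMem q (by simpa using hw),
      firstRealized_apply_of_notMem q (by simp)]
  | cons u l ih =>
    simp only [List.forall_mem_cons] at h0 h1
    rw [List.cons_append, firstRealized_cons_apply h0.1 h1.1, firstRealized_cons_apply h0.1 h1.1,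
      ih h0.2 h1.2]

lemma sum_firstRealized [Fintype B] (q : B → ℝ) {U : Finset B} {l : List B} (hl : l.Nodup)
    (hU : l.toFinset = U) (h0 : ∀ u ∈ U, 0 ≤ q u) (h1 : ∀ u ∈ U, q u ≤ 1) :
    ∑ u ∈ U, (firstRealized q l (some u)).toReal = 1 - ∏ u ∈ U, (1 - q u) := by
  subst hU
  have hs := sum_toReal (firstRealized q l)
  rw [Fintype.sum_option, firstRealized_apply_none q l (by simpa using h0) (by simpa using h1),
    ← List.prod_toFinset _ hl, ENNReal.toReal_ofReal
      (Finset.prod_nonneg fun u hu => sub_nonneg.2 (h1 u hu))] at hs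
  rw [Finset.sum_subset (Finset.subset_univ _) fun u _ hu => by
    rw [firstRealized_apply_of_notMem q (by simpa using hu), ENNReal.toReal_zero]]
  linarith

/-- The greedy order maximizes a nonnegative linear functional over the polymatroid. -/
lemma exists_list_sum_le [Fintype B] (q x : B → ℝ) (U : Finset B) (h0 : ∀ u ∈ U, 0 ≤ q u)
    (h1 : ∀ u ∈ U, q u ≤ 1)
    (hx : ∀ F ⊆ U, ∑ u ∈ F, x u ≤ 1 - ∏ u ∈ F, (1 - q u)) (c : B → ℝ) (hc : ∀ u ∈ U, 0 ≤ c u) :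
    ∃ l : List B, l.Nodup ∧ l.toFinset = U ∧
      ∑ u ∈ U, c u * x u ≤ ∑ u ∈ U, c u * (firstRealized q l (some u)).toReal := by
  induction U using Finset.strongInduction generalizing c with
  | H U ih =>
    rcases U.eq_empty_or_nonempty with rfl | hne
    · exact ⟨[], by simp⟩
    obtain ⟨v, hv, hmin⟩ := U.exists_min_image c hne
    have hsub := Finset.erase_subset v U
    obtain ⟨l, hl, hlU, hle⟩ := ih _ (Finset.erase_ssubset hv) (fun u hu => h0 u (hsub hu))
      (fun u hu => h1 u (hsub hu)) (fun F hF => hx F (hF.trans hsub)) (fun u => c u - c v)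
      (fun u hu => sub_nonneg.2 (hmin u (hsub hu)))
    have hmem : ∀ u, u ∈ l ↔ u ∈ U.erase v := fun u => by rw [← hlU, List.mem_toFinset]
    have hnd : (l ++ [v]).Nodup := by
      rw [List.nodup_append]
      refine ⟨hl, by simp, fun a ha b hb => ?_⟩
      rw [List.mem_singleton.1 hb]
      exact Finset.ne_of_mem_erase ((hmem a).1 ha)
    have hUl : (l ++ [v]).toFinset = U := by
      rw [List.toFinset_append, hlU]
      ext u
      by_cases h : u = v
      · subst h; simp [hv]
      · simp [h]
    refine ⟨l ++ [v], hnd, hUl, ?_⟩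
    have hsum := sum_firstRealized q hnd hUl h0 h1
    -- Subtracting the smallest weight `c v` removes `v` from the first sum. The second sum is the
    -- constraint for all of `U`, which is tight for every permutation of `U`; `v` can thus be
    -- appended last.
    have hsplit : ∀ y : B → ℝ, ∑ u ∈ U, c u * y u =
        ∑ u ∈ U.erase v, (c u - c v) * y u + c v * ∑ u ∈ U, y u := by
      intro y
      have h2 : ∑ u ∈ U, (c u - c v) * y u = ∑ u ∈ U.erase v, (c u - c v) * y u := by
        rw [← Finset.add_sum_erase _ _ hv]; simp
      rw [← h2, Finset.mul_sum, ← Finset.sum_add_distrib]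
      exact Finset.sum_congr rfl fun u _ => by ring
    rw [hsplit, hsplit fun u => (firstRealized q (l ++ [v]) (some u)).toReal, hsum]
    refine add_le_add (hle.trans_eq (Finset.sum_congr rfl fun u hu => ?_))
      (mul_le_mul_of_nonneg_left (hx U subset_rfl) (hc v hv))
    rw [firstRealized_append_of_ne q l (fun u hu => h0 u (hsub ((hmem u).1 hu)))
      (fun u hu => h1 u (hsub ((hmem u).1 hu))) (Finset.ne_of_mem_erase hu)]

/-- A point of the polymatroid is a mixture of the vectors that belong to permutations of
subsets. -/
lemma mem_convexHull_firstRealized [Fintype B] (q x : B → ℝ) (U : Finset B)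
    (h0 : ∀ u ∈ U, 0 ≤ q u) (h1 : ∀ u ∈ U, q u ≤ 1) (hx0 : ∀ u ∈ U, 0 ≤ x u)
    (hx : ∀ F ⊆ U, ∑ u ∈ F, x u ≤ 1 - ∏ u ∈ F, (1 - q u)) :
    (fun u => if u ∈ U then x u else 0) ∈ convexHull ℝ
      ((fun (l : List B) (u : B) => (firstRealized q l (some u)).toReal) ''
        {l | l.Nodup ∧ ∀ u ∈ l, u ∈ U}) := by
  by_contra hnot
  have hfin : {l : List B | l.Nodup ∧ ∀ u ∈ l, u ∈ U}.Finite :=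
    (Set.finite_range (Subtype.val : {l : List B // l.Nodup} → List B)).subset
      fun l hl => ⟨⟨l, hl.1⟩, rfl⟩
  obtain ⟨f, a, hlt, hgt⟩ := geometric_hahn_banach_closed_point (convex_convexHull ℝ _)
    ((hfin.image _).isClosed_convexHull ℝ) hnot
  have hf : ∀ z : B → ℝ, f z = ∑ u, f (Pi.single u 1) * z u := by
    intro z
    have := LinearMap.pi_apply_eq_sum_univ (f : (B → ℝ) →ₗ[ℝ] ℝ) z
    simp only [ContinuousLinearMap.coe_coe, smul_eq_mul] at this
    rw [this]
    refine Finset.sum_congr rfl fun u _ => ?_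
    rw [mul_comm]
    congr 2
    ext v
    simp [Pi.single_apply, eq_comm]
  set c : B → ℝ := fun u => f (Pi.single u 1)
  -- Edges with negative coefficients are left out of the list, hence permutations of subsets. The
  -- remaining ones, in greedy order, contradict the separation.
  let W := U.filter fun u => 0 ≤ c u
  have hWU : W ⊆ U := Finset.filter_subset _ _
  obtain ⟨l, hl, hlW, hle⟩ := exists_list_sum_le q x W (fun u hu => h0 u (hWU hu))
    (fun u hu => h1 u (hWU hu)) (fun F hF => hx F (hF.trans hWU)) c
    fun u hu => (Finset.mem_filter.1 hu).2
  have hmem : ∀ u, u ∈ l ↔ u ∈ W := fun u => by rw [← hlW, List.mem_toFinset]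
  have hltl := hlt _ (subset_convexHull ℝ _ ⟨l, ⟨hl, fun u hu => hWU ((hmem u).1 hu)⟩, rfl⟩)
  rw [hf] at hltl hgt
  have hA : ∑ u, c u * (if u ∈ U then x u else 0) ≤ ∑ u ∈ W, c u * x u := by
    simp only [mul_ite, mul_zero, Finset.sum_ite_mem, Finset.univ_inter, W, Finset.sum_filter]
    refine Finset.sum_le_sum fun u hu => ?_
    split_ifs with h
    · exact le_rfl
    · exact mul_nonpos_of_nonpos_of_nonneg (not_le.1 h).le (hx0 u hu)
  have hB : ∑ u ∈ W, c u * (firstRealized q l (some u)).toReal =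
      ∑ u, c u * (firstRealized q l (some u)).toReal :=
    Finset.sum_subset (Finset.subset_univ _) fun u _ hu => by
      rw [firstRealized_apply_of_notMem q (mt (hmem u).1 hu), ENNReal.toReal_zero, mul_zero]
  linarith

lemma exists_pmf_firstRealized [Fintype B] (q x : B → ℝ) (U : Finset B)
    (h0 : ∀ u ∈ U, 0 ≤ q u) (h1 : ∀ u ∈ U, q u ≤ 1) (hx0 : ∀ u ∈ U, 0 ≤ x u)
    (hx : ∀ F ⊆ U, ∑ u ∈ F, x u ≤ 1 - ∏ u ∈ F, (1 - q u)) :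
    ∃ D : PMF (List B), (∀ l ∈ D.support, l.Nodup ∧ ∀ u ∈ l, u ∈ U) ∧
      ∀ u ∈ U, (D.bind (firstRealized q)) (some u) = ENNReal.ofReal (x u) := by
  obtain ⟨ι, _, w, z, hw0, hw1, hz, hsum⟩ :=
    mem_convexHull_iff_exists_fintype.1 (mem_convexHull_firstRealized q x U h0 h1 hx0 hx)
  choose L hL hLz using hz
  let P : PMF ι := PMF.ofFintype (fun i => ENNReal.ofReal (w i)) (by
    rw [← ENNReal.ofReal_sum_of_nonneg fun i _ => hw0 i, hw1, ENNReal.ofReal_one])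
  refine ⟨P.map L, fun l hl => ?_, fun u hu => ?_⟩
  · obtain ⟨i, -, rfl⟩ := (PMF.mem_support_map_iff _ _ _).1 hl
    exact hL i
  · have hu' := congrFun hsum u
    simp only [Finset.sum_apply, Pi.smul_apply, smul_eq_mul, hu, if_true] at hu'
    rw [PMF.bind_map, PMF.bind_apply, tsum_fintype, ← hu',
      ENNReal.ofReal_sum_of_nonneg fun i _ => mul_nonneg (hw0 i)
        (by rw [← hLz i]; exact ENNReal.toReal_nonneg)]
    refine Finset.sum_congr rfl fun i _ => ?_
    rw [ENNReal.ofReal_mul (hw0 i), ← hLz i, ENNReal.ofReal_toReal (PMF.apply_ne_top _ _)]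
    rfl

lemma exists_isProportional {V : Type*} [DecidableEq V] [Fintype B] (E : Finset (V × B))
    (p x : V × B → ℝ) (v : V)
    (h0 : ∀ e ∈ E, 0 ≤ p e) (h1 : ∀ e ∈ E, p e ≤ 1) (hx0 : ∀ e ∈ E, 0 ≤ x e)
    (hx : ∀ F ⊆ E, (∀ e ∈ F, e.1 = v) → ∑ e ∈ F, x e ≤ prExists p F) :
    ∃ D : PMF (List B), IsProportional E p x v D := by
  let U : Finset B := Finset.univ.filter fun u => (v, u) ∈ E
  have hU : ∀ u, u ∈ U ↔ (v, u) ∈ E := fun u => by simp [U]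
  obtain ⟨D, hD, hDx⟩ := exists_pmf_firstRealized (fun u => p (v, u)) (fun u => x (v, u)) U
    (fun u hu => h0 _ ((hU u).1 hu)) (fun u hu => h1 _ ((hU u).1 hu))
    (fun u hu => hx0 _ ((hU u).1 hu)) (fun F hF => by
      have h := hx (F.map ⟨fun u => (v, u), fun _ _ h => (Prod.ext_iff.1 h).2⟩)
        (fun e he => by
          obtain ⟨u, hu, rfl⟩ := Finset.mem_map.1 he
          exact (hU u).1 (hF hu))
        (fun e he => by
          obtain ⟨u, -, rfl⟩ := Finset.mem_map.1 he
          rfl)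
      rw [prExists, Finset.sum_map, Finset.prod_map] at h
      exact h)
  exact ⟨D, fun l hl => ⟨(hD l hl).1, fun u hu => (hU u).1 ((hD l hl).2 u hu)⟩,
    fun u hu => hDx u ((hU u).2 hu)⟩

end Greedy

/-! ### The linear program -/

section LP

variable {V B : Type*} {E : Finset (V × B)} {p w x : V × B → ℝ}

lemma LPFeasible.le (hx : LPFeasible E p x) {e : V × B} (he : e ∈ E) : x e ≤ p e := by
  have h := hx.2.1 e.1 {e} (by simpa using he) (by simp)
  simpa [prExists] using h

lemma LPFeasible.mono {y : V × B → ℝ} (hx : LPFeasible E p x) (h0 : ∀ e ∈ E, 0 ≤ y e)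
    (hyx : ∀ e ∈ E, y e ≤ x e) : LPFeasible E p y :=
  ⟨h0, fun v F hF hv => (Finset.sum_le_sum fun e he => hyx e (hF he)).trans (hx.2.1 v F hF hv),
    fun u F hF hu => (Finset.sum_le_sum fun e he => hyx e (hF he)).trans (hx.2.2 u F hF hu)⟩

/-- Setting one coordinate to zero keeps feasibility, so a negative weight there would contradict
optimality. -/
lemma LPOptimal.weight_nonneg (hx : LPOptimal E p w x) {e : V × B}
    (he : e ∈ E) (hxe : 0 < x e) : 0 ≤ w e := by
  classical
  have hy : LPFeasible E p (Function.update x e 0) := by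
    refine hx.1.mono (fun f hf => ?_) (fun f hf => ?_)
    · rcases eq_or_ne f e with rfl | h
      · simp
      · rw [Function.update_of_ne h]; exact hx.1.1 f hf
    · rcases eq_or_ne f e with rfl | h
      · simpa using hxe.le
      · rw [Function.update_of_ne h]
  have h := hx.2 _ hy
  rw [value, value, ← Finset.add_sum_erase _ _ he, ← Finset.add_sum_erase E _ he,
    Finset.sum_congr rfl fun f hf => by
      rw [Function.update_of_ne (Finset.ne_of_mem_erase hf)]] at h
  simp only [Function.update_self, mul_zero, zero_add, le_add_iff_nonneg_left] at h
  exact nonneg_of_mul_nonneg_left h hxe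

variable [DecidableEq V] [DecidableEq B]

lemma sum_prob_eq_one (E : Finset (V × B)) (p : V × B → ℝ) :
    ∑ R ∈ E.powerset, (∏ e ∈ R, p e) * (∏ e ∈ E \ R, (1 - p e)) = 1 := by
  rw [← Finset.prod_add]
  simp

/-- Expand `∏ (p e + (1 - p e))` after replacing `p e` by `0` on `F`: exactly the terms with `R`
disjoint from `F` survive. -/
lemma sum_prob_disjoint {F : Finset (V × B)} (hF : F ⊆ E) (p : V × B → ℝ) :
    ∑ R ∈ E.powerset, (∏ e ∈ R, p e) * (∏ e ∈ E \ R, (1 - p e)) *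
      (if Disjoint R F then 1 else 0) = ∏ e ∈ F, (1 - p e) := by
  have h := Finset.prod_add (fun e => if e ∈ F then 0 else p e) (fun e => 1 - p e) E
  have h1 : ∏ e ∈ E, ((if e ∈ F then 0 else p e) + (1 - p e)) = ∏ e ∈ F, (1 - p e) := by
    rw [← Finset.prod_subset hF fun e _ he => by simp [he]]
    exact Finset.prod_congr rfl fun e he => by simp [he]
  rw [← h1, h]
  refine Finset.sum_congr rfl fun R _ => ?_
  split_ifs with hd
  · rw [mul_one]
    congr 1
    exact Finset.prod_congr rfl fun e he => (if_neg (Finset.disjoint_left.1 hd he)).symm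
  · obtain ⟨e, he, heF⟩ := Finset.not_disjoint_iff.1 hd
    have h0 : ∏ e ∈ R, (if e ∈ F then 0 else p e) = 0 := Finset.prod_eq_zero he (if_pos heF)
    rw [h0, mul_zero, zero_mul]

/-- The linear program is a relaxation of stochastic matching. -/
lemma opt_le_value (hp0 : ∀ e ∈ E, 0 ≤ p e) (hp1 : ∀ e ∈ E, p e ≤ 1) (hx : LPOptimal E p w x) :
    opt E p w ≤ value E w x := by
  classical
  have hex : ∀ R : Finset (V × B), ∃ M : Finset (V × B), M ⊆ R ∧ IsMatching M ∧
      maxWeight w R = ∑ e ∈ M, w e := by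
    intro R
    obtain ⟨M, hM, h⟩ := Finset.exists_mem_eq_sup' (s := R.powerset.filter IsMatching)
      ⟨∅, Finset.mem_filter.2 ⟨Finset.empty_mem_powerset R, fun e he => absurd he (by simp)⟩⟩
      (fun M => ∑ e ∈ M, w e)
    rw [Finset.mem_filter, Finset.mem_powerset] at hM
    exact ⟨M, hM.1, hM.2, h⟩
  choose M hMR hM hMw using hex
  set P : Finset (V × B) → ℝ := fun R => (∏ e ∈ R, p e) * (∏ e ∈ E \ R, (1 - p e)) with hP
  have hP0 : ∀ R ∈ E.powerset, 0 ≤ P R := fun R hR =>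
    mul_nonneg (Finset.prod_nonneg fun e he => hp0 e (Finset.mem_powerset.1 hR he))
      (Finset.prod_nonneg fun e he => sub_nonneg.2 (hp1 e (Finset.mem_sdiff.1 he).1))
  -- `y e` is the probability that `e` lies in the maximum weight matching chosen for the realized
  -- graph.
  set y : V × B → ℝ := fun e => ∑ R ∈ E.powerset, P R * (if e ∈ M R then 1 else 0) with hy
  -- Pairwise adjacency covers the stars on both sides at once: a matching contains at most one edge
  -- of `F`, and none unless `R` meets `F`.
  have hsum : ∀ F ⊆ E, (∀ e ∈ F, ∀ f ∈ F, e.1 = f.1 ∨ e.2 = f.2) →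
      ∑ e ∈ F, y e ≤ prExists p F := by
    intro F hF hadj
    have hpr : prExists p F = ∑ R ∈ E.powerset, P R * (1 - if Disjoint R F then 1 else 0) := by
      simp only [mul_sub, mul_one, Finset.sum_sub_distrib]
      rw [prExists, ← sum_prob_disjoint hF p, hP, sum_prob_eq_one E p]
    rw [hpr, hy, Finset.sum_comm]
    refine Finset.sum_le_sum fun R hR => ?_
    rw [← Finset.mul_sum]
    refine mul_le_mul_of_nonneg_left ?_ (hP0 R hR)
    rw [Finset.sum_ite_mem, Finset.sum_const, nsmul_eq_mul, mul_one]
    split_ifs with hd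
    · rw [Finset.disjoint_iff_inter_eq_empty.1 (Finset.disjoint_of_subset_right (hMR R) hd.symm)]
      simp
    · rw [sub_zero]
      have : (F ∩ M R).card ≤ 1 := by
        refine Finset.card_le_one.2 fun e he f hf => ?_
        rw [Finset.mem_inter] at he hf
        by_contra hne
        have h := hM R e he.2 f hf.2 hne
        exact (hadj e he.1 f hf.1).elim h.1 h.2
      exact_mod_cast this
  have hfeas : LPFeasible E p y :=
    ⟨fun e _ => Finset.sum_nonneg fun R hR => mul_nonneg (hP0 R hR) (by split_ifs <;> simp),
      fun v F hF hv => hsum F hF fun e he f hf => Or.inl ((hv e he).trans (hv f hf).symm),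
      fun u F hF hu => hsum F hF fun e he f hf => Or.inr ((hu e he).trans (hu f hf).symm)⟩
  refine le_of_eq_of_le ?_ (hx.2 y hfeas)
  simp only [opt, value, hy, Finset.mul_sum]
  rw [Finset.sum_comm]
  refine Finset.sum_congr rfl fun R hR => ?_
  rw [hMw, Finset.mul_sum, ← Finset.inter_eq_right.2
    ((hMR R).trans (Finset.mem_powerset.1 hR)), ← Finset.sum_ite_mem]
  refine Finset.sum_congr rfl fun e _ => ?_
  rw [Finset.inter_eq_right.2 ((hMR R).trans (Finset.mem_powerset.1 hR))]
  split_ifs <;> simp [hP]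
  ring

end LP

/-! ### The graph with its dummy edges -/

section Dummy

variable {A B : Type*} [DecidableEq A] [DecidableEq B] [Fintype B] {F : Finset (A × B)}
  {p x w : A × B → ℝ} {σ : ℝ}

lemma inl_mem_extEdges {a : A} {u : B} : (Sum.inl a, u) ∈ extEdges F ↔ (a, u) ∈ F := by
  simp [extEdges]

lemma inr_mem_extEdges {b u : B} : (Sum.inr b, u) ∈ extEdges F ↔ b = u := by
  simp [extEdges]

lemma forall_mem_extEdges {Q : (A ⊕ B) × B → Prop} :
    (∀ e ∈ extEdges F, Q e) ↔
      (∀ e ∈ F, Q (Sum.inl e.1, e.2)) ∧ ∀ u, Q (Sum.inr u, u) := by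
  constructor
  · exact fun h => ⟨fun e he => h _ (inl_mem_extEdges.2 he), fun u => h _ (inr_mem_extEdges.2 rfl)⟩
  · rintro ⟨h1, h2⟩ ⟨a | b, u⟩ he
    · exact h1 _ (inl_mem_extEdges.1 he)
    · obtain rfl := inr_mem_extEdges.1 he
      exact h2 b

lemma extX_nonneg (hx0 : ∀ e ∈ F, 0 ≤ x e) (hF : ∀ u, ∑ e ∈ F with e.2 = u, x e ≤ σ) :
    ∀ e ∈ extEdges F, 0 ≤ extX F x σ e :=
  forall_mem_extEdges.2 ⟨hx0, fun u => sub_nonneg.2 (hF u)⟩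

lemma extX_le (hx0 : ∀ e ∈ F, 0 ≤ x e) (hF : ∀ u, ∑ e ∈ F with e.2 = u, x e ≤ σ) :
    ∀ e ∈ extEdges F, extX F x σ e ≤ σ := by
  refine forall_mem_extEdges.2 ⟨fun e he => ?_, fun u => ?_⟩
  · refine le_trans ?_ (hF e.2)
    exact Finset.single_le_sum (f := x) (fun f hf => hx0 f (Finset.mem_filter.1 hf).1)
      (Finset.mem_filter.2 ⟨he, rfl⟩)
  · have : 0 ≤ ∑ e ∈ F with e.2 = u, x e :=
      Finset.sum_nonneg fun f hf => hx0 f (Finset.mem_filter.1 hf).1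
    simpa [extX] using this

lemma extP_nonneg (hp0 : ∀ e ∈ F, 0 ≤ p e) : ∀ e ∈ extEdges F, 0 ≤ extP p e :=
  forall_mem_extEdges.2 ⟨hp0, fun _ => zero_le_one⟩

lemma extP_le_one (hp1 : ∀ e ∈ F, p e ≤ 1) : ∀ e ∈ extEdges F, extP p e ≤ 1 :=
  forall_mem_extEdges.2 ⟨hp1, fun _ => le_rfl⟩

/-- Original left vertices inherit their LP constraints. A dummy vertex has a single edge with
probability `1`, so its constraint only asks for a value at most `σ ≤ 1`. -/
lemma exists_isProportionalFamily (hp0 : ∀ e ∈ F, 0 ≤ p e) (hp1 : ∀ e ∈ F, p e ≤ 1)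
    (hσ1 : σ ≤ 1) (hx : LPFeasible F p x) (hF : ∀ u, ∑ e ∈ F with e.2 = u, x e ≤ σ) :
    ∃ D : A ⊕ B → PMF (List B), IsProportionalFamily F p x σ D := by
  have key : ∀ v, ∃ D : PMF (List B), IsProportional (extEdges F) (extP p) (extX F x σ) v D := by
    intro v
    refine exists_isProportional _ _ _ v (extP_nonneg hp0) (extP_le_one hp1)
      (extX_nonneg hx.1 hF) fun K hK hKv => ?_
    rcases v with a | b
    · let φ : A × B ↪ (A ⊕ B) × B := ⟨fun e => (Sum.inl e.1, e.2), fun e f h => by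
        simpa [Prod.ext_iff] using h⟩
      obtain ⟨K', hK', rfl⟩ : ∃ K' ⊆ F, K'.map φ = K := by
        refine ⟨F.filter fun e => φ e ∈ K, Finset.filter_subset _ _, ?_⟩
        ext e
        simp only [Finset.mem_map, Finset.mem_filter]
        constructor
        · rintro ⟨f, ⟨-, hf⟩, rfl⟩; exact hf
        · intro he
          have hev := hKv e he
          obtain ⟨e1, u⟩ := e
          obtain rfl : e1 = Sum.inl a := hev
          exact ⟨(a, u), ⟨inl_mem_extEdges.1 (hK he), he⟩, rfl⟩
      rw [prExists, Finset.sum_map, Finset.prod_map]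
      exact hx.2.1 a K' hK' fun e he => Sum.inl_injective (hKv _ (Finset.mem_map_of_mem φ he))
    · have hsub : K ⊆ {(Sum.inr b, b)} := by
        rintro ⟨e1, u⟩ he
        obtain rfl : e1 = Sum.inr b := hKv _ he
        simp [inr_mem_extEdges.1 (hK he)]
      rcases Finset.subset_singleton_iff.1 hsub with rfl | rfl
      · simp [prExists]
      · simpa [prExists, extP] using (extX_le hx.1 hF _ (hK (Finset.mem_singleton_self _))).trans hσ1
  choose D hD using key
  exact ⟨D, hD⟩

/-- The fractional value between `v` and `u` in the extended graph, `0` for non-edges. -/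
def extValue (F : Finset (A × B)) (x : A × B → ℝ) (σ : ℝ) (u : B) (v : A ⊕ B) : ℝ :=
  if (v, u) ∈ extEdges F then extX F x σ (v, u) else 0

lemma alg1_proposal (hσ : 0 < σ) (hp0 : ∀ e ∈ F, 0 ≤ p e) (hp1 : ∀ e ∈ F, p e ≤ 1)
    (hx0 : ∀ e ∈ F, 0 ≤ x e) (hF : ∀ u, ∑ e ∈ F with e.2 = u, x e ≤ σ)
    {D : A ⊕ B → PMF (List B)} (hD : IsProportionalFamily F p x σ D) (u : B) (v : A ⊕ B) :
    (proposal (extP p) (extX F x σ) (fun e => g (extX F x σ e) σ) (D v) v (some u)).toReal =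
      g (extValue F x σ u v) σ := by
  have hX0 := extX_nonneg hx0 hF
  have hX1 := extX_le hx0 hF
  rw [extValue]
  split_ifs with h
  · rw [proposal_apply (extP_nonneg hp0) (extP_le_one hp1)
      (fun e he => g_nonneg (hX0 e he) (hX1 e he))
      (fun e he => g_le_self (hX0 e he) (hX1 e he) hσ) (hD v) h,
      ENNReal.toReal_ofReal (g_nonneg (hX0 _ h) (hX1 _ h))]
  · rw [proposal_apply_of_notMem (hD v) h, g_zero hσ, ENNReal.toReal_zero]

variable [Fintype A]

lemma alg1_support {D : A ⊕ B → PMF (List B)} (hD : IsProportionalFamily F p x σ D)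
    {M : Finset ((A ⊕ B) × B)} (hM : M ∈ (alg1 F p x σ D).support) :
    IsMatching M ∧ M ⊆ extEdges F :=
  runRandom_support (fun v _ h => mem_edges_of_some_mem_support_proposal (hD v) h) hM

/-- The purpose of the dummy edges: the total is `σ` at every `u`, so the values competing with `v`
add up to `σ - X v`. -/
lemma sum_extValue (u : B) : ∑ v, extValue F x σ u v = σ := by
  have h1 : ∑ e ∈ F with e.2 = u, x e = ∑ a, if (a, u) ∈ F then x (a, u) else 0 := by
    rw [← Finset.sum_filter]
    refine (Finset.sum_bij' (fun a _ => (a, u)) (fun e _ => e.1) ?_ ?_ ?_ ?_ ?_).symm <;>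
      simp +contextual [Prod.ext_iff]
    rintro a b h rfl
    exact h
  rw [Fintype.sum_sum_type]
  simp only [extValue, inl_mem_extEdges, inr_mem_extEdges, extX, Finset.sum_ite_eq',
    Finset.mem_univ, if_true]
  rw [h1]
  ring

lemma le_prob_mem_alg1 (hσ : 0 < σ) (hσ1 : σ ≤ 1) (hp0 : ∀ e ∈ F, 0 ≤ p e)
    (hp1 : ∀ e ∈ F, p e ≤ 1) (hx0 : ∀ e ∈ F, 0 ≤ x e)
    (hF : ∀ u, ∑ e ∈ F with e.2 = u, x e ≤ σ)
    {D : A ⊕ B → PMF (List B)} (hD : IsProportionalFamily F p x σ D) {e : (A ⊕ B) × B}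
    (he : e ∈ extEdges F) :
    (1 - Real.exp (-σ)) / σ * extX F x σ e ≤
      expect (alg1 F p x σ D) (fun M => if e ∈ M then 1 else 0) := by
  obtain ⟨v, u⟩ := e
  rw [alg1, expect_runRandom]
  simp only [alg1_proposal hσ hp0 hp1 hx0 hF hD]
  have h := le_g_mul_sum_powerset hσ hσ1 (extValue F x σ u)
    (fun v => by rw [extValue]; split_ifs with h; exacts [extX_nonneg hx0 hF _ h, le_rfl])
    (sum_extValue u) v
  rwa [show extX F x σ (v, u) = extValue F x σ u v from (if_pos he).symm]

lemma expect_weight (P : PMF (Finset ((A ⊕ B) × B))) :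
    expect P (weight w) =
      ∑ e : A × B, w e * expect P (fun M => if (Sum.inl e.1, e.2) ∈ M then 1 else 0) := by
  have h1 : ∀ M : Finset ((A ⊕ B) × B), weight w M =
      ∑ e : A × B, w e * (if (Sum.inl e.1, e.2) ∈ M then 1 else 0) := by
    intro M
    have h2 : weight w M = ∑ e : (A ⊕ B) × B, if e ∈ M then extW w e else 0 := by
      rw [weight, Finset.sum_ite_mem, Finset.univ_inter]
    rw [h2, Fintype.sum_prod_type, Fintype.sum_sum_type, Fintype.sum_prod_type]
    simp [extW]
  simp only [expect, h1, Finset.mul_sum]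
  rw [Finset.sum_comm]
  refine Finset.sum_congr rfl fun e _ => Finset.sum_congr rfl fun M _ => ?_
  ring

lemma le_expect_weight_alg1 (hσ : 0 < σ) (hσ1 : σ ≤ 1) (hp0 : ∀ e ∈ F, 0 ≤ p e)
    (hp1 : ∀ e ∈ F, p e ≤ 1) (hx0 : ∀ e ∈ F, 0 ≤ x e) (hw : ∀ e ∈ F, 0 ≤ w e)
    (hF : ∀ u, ∑ e ∈ F with e.2 = u, x e ≤ σ)
    {D : A ⊕ B → PMF (List B)} (hD : IsProportionalFamily F p x σ D) :
    (1 - Real.exp (-σ)) / σ * value F w x ≤ expect (alg1 F p x σ D) (weight w) := by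
  rw [expect_weight, value, Finset.mul_sum, ← Finset.sum_subset (Finset.subset_univ F)]
  · refine Finset.sum_le_sum fun e he => ?_
    rw [mul_left_comm]
    exact mul_le_mul_of_nonneg_left
      (le_prob_mem_alg1 hσ hσ1 hp0 hp1 hx0 hF hD (inl_mem_extEdges.2 he)) (hw e he)
  · intro e _ he
    refine mul_eq_zero_of_right _ (Finset.sum_eq_zero fun M _ => ?_)
    by_cases hM : M ∈ (alg1 F p x σ D).support
    · exact mul_eq_zero_of_right _
        (if_neg fun h => he (inl_mem_extEdges.1 ((alg1_support hD hM).2 h)))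
    · rw [(PMF.apply_eq_zero_iff _ _).2 hM, ENNReal.toReal_zero, zero_mul]

end Dummy

end StochMatch

end

/-! ### The approximation guarantee -/

theorem lemma6 {A B : Type*} [Fintype A] [Fintype B] [DecidableEq A] [DecidableEq B]
    (E : Finset (A × B)) (p w x : A × B → ℝ)
    (hp : ∀ e ∈ E, 0 < p e ∧ p e ≤ 1)
    (hx : StochMatch.LPOptimal E p w x)
    (hopt : 0 < StochMatch.opt E p w)
    (τ : ℝ) (hτ : 3 / 4 ≤ τ) (hτ' : τ < 1)
    (H : Finset (A × B))
    (hH : E \ StochMatch.lightEdges E p x τ ⊆ H)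
    (hH' : H ⊆ StochMatch.heavyEdges E p x τ) :
    IsLeast (StochMatch.phiSet τ) (StochMatch.phi τ) ∧
    IsGreatest (StochMatch.rhoSet τ) (StochMatch.rho τ) ∧
    StochMatch.rho τ < 1 ∧
    (∀ v : A, ∑ e ∈ H with e.1 = v, x e ≤ StochMatch.rho τ) ∧
    (∀ u : B, ∑ e ∈ H with e.2 = u, x e ≤ StochMatch.rho τ) ∧
    (∃ D : A ⊕ B → PMF (List B),
      StochMatch.IsProportionalFamily H p x (StochMatch.rho τ) D) ∧
    ∀ D : A ⊕ B → PMF (List B),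
      StochMatch.IsProportionalFamily H p x (StochMatch.rho τ) D →
      (∀ M ∈ (StochMatch.alg1 H p x (StochMatch.rho τ) D).support,
        StochMatch.IsMatching M ∧ M ⊆ StochMatch.extEdges H) ∧
      (1 - Real.exp (-StochMatch.rho τ)) / StochMatch.rho τ *
          (StochMatch.value H w x / StochMatch.value E w x) ≤
        StochMatch.expect (StochMatch.alg1 H p x (StochMatch.rho τ) D) (StochMatch.weight w) /
          StochMatch.opt E p w := by
  classical
  have hσ := StochMatch.rho_pos hτ hτ'
  have hσ1 := StochMatch.rho_lt_one hτ hτ'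
  have hHE : H ⊆ E := hH'.trans (Finset.filter_subset _ _)
  have hheavy : ∀ e ∈ H, τ ≤ StochMatch.g (x e) 1 / p e :=
    fun e he => (Finset.mem_filter.1 (hH' he)).2
  have hxp : ∀ e ∈ H, x e ≤ p e := fun e he => hx.1.le (hHE he)
  have hp0 : ∀ e ∈ E, 0 ≤ p e := fun e he => (hp e he).1.le
  have hp1 : ∀ e ∈ E, p e ≤ 1 := fun e he => (hp e he).2
  -- Because `g 0 1 = 0`, an edge of value `0` is never heavy; positivity of `x` then gives
  -- nonnegative weights on `H`.
  have hxpos : ∀ e ∈ H, 0 < x e := by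
    refine fun e he => lt_of_le_of_ne (hx.1.1 e (hHE he)) fun h => ?_
    have h1 := hheavy e he
    rw [← h, StochMatch.g_zero one_pos, zero_div] at h1
    linarith
  have hw : ∀ e ∈ H, 0 ≤ w e := fun e he => hx.weight_nonneg (hHE he) (hxpos e he)
  have hsum : ∀ F ⊆ H, ∑ e ∈ F, x e ≤ StochMatch.prExists p F →
      ∑ e ∈ F, x e ≤ StochMatch.rho τ := fun F hF h =>
    StochMatch.sum_le_rho hτ hτ' F p x (fun e he => hxpos e (hF he)) (fun e he => hxp e (hF he))
      (fun e he => hp1 e (hHE (hF he))) (fun e he => hheavy e (hF he)) h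
  have hB : ∀ u : B, ∑ e ∈ H with e.2 = u, x e ≤ StochMatch.rho τ := fun u =>
    hsum _ (Finset.filter_subset _ _) (hx.1.2.2 u _ ((Finset.filter_subset _ _).trans hHE)
      fun e he => (Finset.mem_filter.1 he).2)
  have hfeas : StochMatch.LPFeasible H p x :=
    ⟨fun e he => hx.1.1 e (hHE he), fun v F hF => hx.1.2.1 v F (hF.trans hHE),
      fun u F hF => hx.1.2.2 u F (hF.trans hHE)⟩
  refine ⟨StochMatch.isLeast_phi hτ hτ', StochMatch.isGreatest_rho hτ hτ', hσ1, fun v =>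
    hsum _ (Finset.filter_subset _ _) (hx.1.2.1 v _ ((Finset.filter_subset _ _).trans hHE)
      fun e he => (Finset.mem_filter.1 he).2), hB,
    StochMatch.exists_isProportionalFamily (fun e he => hp0 e (hHE he))
      (fun e he => hp1 e (hHE he)) hσ1.le hfeas hB,
    fun D hD => ⟨fun M hM => StochMatch.alg1_support hD hM, ?_⟩⟩
  have hexp := StochMatch.le_expect_weight_alg1 hσ hσ1.le (fun e he => hp0 e (hHE he))
    (fun e he => hp1 e (hHE he)) hfeas.1 hw hB hD
  have hc : 0 ≤ (1 - Real.exp (-StochMatch.rho τ)) / StochMatch.rho τ :=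
    div_nonneg (sub_nonneg.2 (Real.exp_le_one_iff.2 (neg_nonpos.2 hσ.le))) hσ.le
  have hval : 0 ≤ StochMatch.value H w x :=
    Finset.sum_nonneg fun e he => mul_nonneg (hw e he) (hxpos e he).le
  rw [← mul_div_assoc]
  -- The numerator grows and the denominator shrinks, from the LP value to `OPT`.
  exact div_le_div₀ ((mul_nonneg hc hval).trans hexp) hexp hopt
    (StochMatch.opt_le_value hp0 hp1 hx)
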